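/- Let $(M,\omega)$ be a compact Kähler manifold of complex dimension $n$ and let $E\to M$ be a very ample holomorphic vector bundle of rank $r$, with $N=\dim H^0(M,E)$. **Notation.** $G(r,N)=M^*(r,N,\mathbb C)/GL(r,\mathbb C)$ is the Grassmannian of classes $[A]$ of $N\times r$ complex matrices $A$ of rank $r$, where $A\sim Ag$ for $g\in GL(r,\mathbb C)$. $\mathcal T\to G(r,N)$ is the tautological bundle, whose fibre over $[A]$ is the column space of $A$ in $\mathbb C^N$, with the flat metric $h_0(v,w)=w^*v$. $\mathcal Q=\mathcal T^*$ carries the dual metric $h_{Gr}=h_0^*$. For a Hermitian metric $h$ on a holomorphic bundle, $\operatorname{Ric}(h)=-\frac i2\,\partial\bar\partial\log\det\big(h(\sigma_\alpha,\sigma_\beta)\big)$ in any local holomorphic frame $\sigma$. Put $\omega_{Gr}=\operatorname{Ric}(h_{Gr})$. For a basis $\underline s=(s_1,\dots,s_N)$ of $H^0(M,E)$ that spans every fibre of $E$, the Kodaira map $i_{\underline s}:M\to G(r,N)$ is $x\mapsto[(S_{j\alpha}(x))]$, where $s_j=\sum_\alpha S_{j\alpha}\sigma_\alpha$ in a local frame.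 $E$ is very ample if $H^0(M,E)$ is finite dimensional and spans every fibre of $E$, and $i_{\underline s}$ is a holomorphic embedding for every basis $\underline s$. Via $E=i_{\underline s}^*\mathcal Q$ (where $s_j$ corresponds to the $j$-th coordinate function) put $h_{\underline s}=i_{\underline s}^*h_{Gr}$. The basis $\underline s$ is $\omega$-balanced if $$\frac1{V(M)}\int_M h_{\underline s}(s_j,s_k)\,\frac{\omega^n}{n!}=\frac rN\,\delta_{jk}\qquad(1\le j,k\le N),\qquad V(M)=\int_M\frac{\omega^n}{n!}.$$ A Hermitian metric $h$ on $E$ is $\omega$-balanced if $h=h_{\underline s}$ for some $\omega$-balanced basis $\underline s$ of $H^0(M,E)$. A map $f:M\to G(r,N)$ is $\omega$-balanced if $f=i_{\underline s}$ for some very ample holomorphic vector bundle $E'\to M$ of rank $r$ with $\dim H^0(M,E')=N$ and some $\omega$-balanced basis $\underline s$ of $H^0(M,E')$. A holomorphic map $f:M\to G(r,N)$ is Kähler if $f^*\omega_{Gr}=\omega$. **Theorem.** Suppose that $E$ admits an $\omega$-balanced Hermitian metric $h$ with $\operatorname{Ric}(h)=\omega$. Then there is an $\omega$-balanced Kähler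 embedding $f:M\to G(r,N)$ such that $f^*\mathcal Q$ is holomorphically isomorphic to $E$. It is unique up to unitary transformations of $G(r,N)$: if $g:M\to G(r,N)$ is another $\omega$-balanced Kähler embedding with $g^*\mathcal Q\cong E$, then there is $U\in U(N)$ such that $g(x)=U\cdot f(x)$ for all $x\in M$, where $U\cdot[A]=[UA]$. -/

import Mathlib

open Bundle Set Topology
open scoped Manifold ContDiff Bundle Topology Matrix

noncomputable section
namespace Balanced

/-- `M^*(r, N, ℂ)`: the `N × r` complex matrices of rank `r`. -/
abbrev FullRank (r N : ℕ) : Type := {A : Matrix (Fin N) (Fin r) ℂ // A.rank = r}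

/-- Two matrices of rank `r` are equivalent if they differ by right multiplication
by an element of `GL(r, ℂ)`. -/
instance frameSetoid (r N : ℕ) : Setoid (FullRank r N) where
  r A B := ∃ g : GL (Fin r) ℂ, B.1 = A.1 * (g : Matrix (Fin r) (Fin r) ℂ)
  iseqv :=
    { refl := fun A => ⟨1, by simp⟩
      symm := by
        rintro A B ⟨g, hg⟩
        exact ⟨g⁻¹, by rw [hg, Matrix.mul_assoc, ← Units.val_mul]; simp⟩
      trans := by
        rintro A B C ⟨g, hg⟩ ⟨k, hk⟩
        exact ⟨g * k, by rw [hk, hg, Matrix.mul_assoc, Units.val_mul]⟩ }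

/-- The Grassmannian `G(r, N) = M^*(r, N, ℂ) / GL(r, ℂ)`, with the quotient topology. -/
def Gr (r N : ℕ) : Type := Quotient (frameSetoid r N)

namespace Gr

variable {r N : ℕ}

instance : TopologicalSpace (Gr r N) :=
  inferInstanceAs (TopologicalSpace (Quotient (frameSetoid r N)))

/-- The class `[A]` of a matrix of rank `r`. -/
def mk (A : FullRank r N) : Gr r N := Quotient.mk _ A

theorem exists_rep (p : Gr r N) : ∃ A : FullRank r N, mk A = p := Quotient.exists_rep p

theorem isQuotientMap_mk : IsQuotientMap (mk : FullRank r N → Gr r N) := isQuotientMap_quotient_mk'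

theorem mk_eq_of {A B : FullRank r N} {g : Matrix (Fin r) (Fin r) ℂ} (hg : g.det ≠ 0)
    (h : B.1 = A.1 * g) : mk A = mk B :=
  Quotient.sound ⟨Matrix.GeneralLinearGroup.mkOfDetNeZero g hg, h⟩

/-- The square block of `A` formed by the rows selected by `e`. -/
def topBlock (e : Fin r ⊕ Fin (N - r) ≃ Fin N) (A : Matrix (Fin N) (Fin r) ℂ) :
    Matrix (Fin r) (Fin r) ℂ := A.submatrix (fun i => e (Sum.inl i)) id

theorem topBlock_mul (e : Fin r ⊕ Fin (N - r) ≃ Fin N) (A : Matrix (Fin N) (Fin r) ℂ)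
    (g : Matrix (Fin r) (Fin r) ℂ) : topBlock e (A * g) = topBlock e A * g := by
  ext i j; simp [topBlock, Matrix.mul_apply]

/-- The representative of `p` whose block of rows selected by `e` is the identity
(meaningful where that block is invertible). -/
def normRep (e : Fin r ⊕ Fin (N - r) ≃ Fin N) : Gr r N → Matrix (Fin N) (Fin r) ℂ :=
  Quotient.lift (fun A : FullRank r N => A.1 * (topBlock e A.1)⁻¹) (by
    rintro A B ⟨g, hg⟩
    have h1 : (g : Matrix (Fin r) (Fin r) ℂ) * (g : Matrix (Fin r) (Fin r) ℂ)⁻¹ = 1 :=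
      Matrix.mul_nonsing_inv _ ((Matrix.isUnit_iff_isUnit_det _).1 g.isUnit)
    rw [hg, topBlock_mul, Matrix.mul_inv_rev, Matrix.mul_assoc, ← Matrix.mul_assoc g.1, h1,
      Matrix.one_mul])

theorem normRep_mk (e : Fin r ⊕ Fin (N - r) ≃ Fin N) (A : FullRank r N) :
    normRep e (mk A) = A.1 * (topBlock e A.1)⁻¹ := rfl

/-- The open set of the `p = [A]` for which the rows of `A` selected by `e` are independent. -/
def chartSource (e : Fin r ⊕ Fin (N - r) ≃ Fin N) : Set (Gr r N) :=
  {p | topBlock e (normRep e p) = 1}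

theorem mk_mem_chartSource (e : Fin r ⊕ Fin (N - r) ≃ Fin N) (A : FullRank r N) :
    mk A ∈ chartSource e ↔ (topBlock e A.1).det ≠ 0 := by
  rw [chartSource, mem_ofPred_eq, normRep_mk, topBlock_mul]
  constructor
  · intro h h0
    have := congrArg Matrix.det h
    rw [Matrix.det_mul, h0, zero_mul, Matrix.det_one] at this
    exact zero_ne_one this
  · intro h
    exact Matrix.mul_nonsing_inv _ (isUnit_iff_ne_zero.2 h)

theorem rank_eq_of_topBlock {A : Matrix (Fin N) (Fin r) ℂ} (e : Fin r ⊕ Fin (N - r) ≃ Fin N)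
    (h : topBlock e A = 1) : A.rank = r := by
  apply le_antisymm
  · simpa using A.rank_le_card_width
  · have := A.rank_submatrix_le (fun i => e (Sum.inl i)) id
    rw [show A.submatrix (fun i => e (Sum.inl i)) id = 1 from h, Matrix.rank_one] at this
    simpa using this

/-- The matrix whose rows selected by `e` form the identity and whose other rows form `B`. -/
def affineMatrix (e : Fin r ⊕ Fin (N - r) ≃ Fin N) (B : Fin (N - r) → Fin r → ℂ) :
    Matrix (Fin N) (Fin r) ℂ :=
  fun i => Sum.elim (fun a => (1 : Matrix (Fin r) (Fin r) ℂ) a) B (e.symm i)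

theorem topBlock_affineMatrix (e : Fin r ⊕ Fin (N - r) ≃ Fin N) (B : Fin (N - r) → Fin r → ℂ) :
    topBlock e (affineMatrix e B) = 1 := by
  ext i j; simp [topBlock, affineMatrix]

def affineFullRank (e : Fin r ⊕ Fin (N - r) ≃ Fin N) (B : Fin (N - r) → Fin r → ℂ) :
    FullRank r N :=
  ⟨affineMatrix e B, rank_eq_of_topBlock e (topBlock_affineMatrix e B)⟩

/-- The affine coordinates of `p`: the remaining rows of its normalized representative. -/
def coords (e : Fin r ⊕ Fin (N - r) ≃ Fin N) (p : Gr r N) : Fin (N - r) → Fin r → ℂ :=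
  fun k => normRep e p (e (Sum.inr k))

theorem affineMatrix_coords (e : Fin r ⊕ Fin (N - r) ≃ Fin N) {p : Gr r N}
    (hp : p ∈ chartSource e) : affineMatrix e (coords e p) = normRep e p := by
  ext i j
  obtain ⟨x, rfl⟩ := e.surjective i
  rcases x with a | k
  · have : topBlock e (normRep e p) a j = (1 : Matrix (Fin r) (Fin r) ℂ) a j := by rw [hp]
    simpa [affineMatrix, topBlock] using this.symm
  · simp [affineMatrix, coords]

theorem mk_affine_coords (e : Fin r ⊕ Fin (N - r) ≃ Fin N) {p : Gr r N}
    (hp : p ∈ chartSource e) : mk (affineFullRank e (coords e p)) = p := by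
  have h := affineMatrix_coords e hp
  obtain ⟨A, rfl⟩ := exists_rep p
  rw [mk_mem_chartSource] at hp
  refine (mk_eq_of (g := (topBlock e A.1)⁻¹) ?_ ?_).symm
  · rw [Matrix.det_nonsing_inv, Ring.inverse_eq_inv']
    exact inv_ne_zero hp
  · exact h

theorem normRep_affine (e : Fin r ⊕ Fin (N - r) ≃ Fin N) (B : Fin (N - r) → Fin r → ℂ) :
    normRep e (mk (affineFullRank e B)) = affineMatrix e B := by
  rw [normRep_mk]
  change affineMatrix e B * (topBlock e (affineMatrix e B))⁻¹ = _
  rw [topBlock_affineMatrix, inv_one, Matrix.mul_one]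

theorem affine_mem (e : Fin r ⊕ Fin (N - r) ≃ Fin N) (B : Fin (N - r) → Fin r → ℂ) :
    mk (affineFullRank e B) ∈ chartSource e := by
  rw [mk_mem_chartSource]
  change (topBlock e (affineMatrix e B)).det ≠ 0
  simp [topBlock_affineMatrix]

theorem isOpen_chartSource (e : Fin r ⊕ Fin (N - r) ≃ Fin N) :
    IsOpen (chartSource e : Set (Gr r N)) := by
  rw [← isQuotientMap_mk.isOpen_preimage]
  have : mk ⁻¹' (chartSource e : Set (Gr r N)) = {A | (topBlock e A.1).det ≠ 0} := by
    ext A; exact mk_mem_chartSource e A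
  rw [this]
  refine isOpen_ne_fun ?_ continuous_const
  exact (Continuous.matrix_submatrix continuous_subtype_val _ _).matrix_det

theorem continuousOn_normRep (e : Fin r ⊕ Fin (N - r) ≃ Fin N) :
    ContinuousOn (normRep e) (chartSource e) := by
  rw [isQuotientMap_mk.continuousOn_isOpen_iff (isOpen_chartSource e)]
  have hc : Continuous fun A : FullRank r N => topBlock e A.1 :=
    Continuous.matrix_submatrix continuous_subtype_val _ _
  have : EqOn (normRep e ∘ mk) (fun A : FullRank r N =>
      A.1 * ((topBlock e A.1).det⁻¹ • (topBlock e A.1).adjugate)) (mk ⁻¹' chartSource e) := by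
    intro A hA
    simp only [Function.comp, normRep_mk, Matrix.inv_def, Ring.inverse_eq_inv']
  refine ContinuousOn.congr ?_ this
  intro A hA
  rw [mem_preimage, mk_mem_chartSource] at hA
  refine ContinuousAt.continuousWithinAt ?_
  have h1 : ContinuousAt (fun A : FullRank r N =>
      (topBlock e A.1).det⁻¹ • (topBlock e A.1).adjugate) A :=
    (hc.matrix_det.continuousAt.inv₀ hA).smul hc.matrix_adjugate.continuousAt
  have h2 : ContinuousAt (fun A : FullRank r N => A.1) A := continuous_subtype_val.continuousAt
  have h3 : Continuous fun P : Matrix (Fin N) (Fin r) ℂ × Matrix (Fin r) (Fin r) ℂ => P.1 * P.2 :=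
    continuous_fst.matrix_mul continuous_snd
  exact h3.continuousAt.comp (h2.prodMk h1)

/-- The affine chart of `G(r, N)` attached to a choice `e` of `r` rows. -/
def affineChart (e : Fin r ⊕ Fin (N - r) ≃ Fin N) :
    OpenPartialHomeomorph (Gr r N) (Fin (N - r) → Fin r → ℂ) where
  toFun := coords e
  invFun := fun B => mk (affineFullRank e B)
  source := chartSource e
  target := univ
  map_source' := fun _ _ => mem_univ _
  map_target' := fun B _ => affine_mem e B
  left_inv' := fun _ hp => mk_affine_coords e hp
  right_inv' := fun B _ => by
    funext k
    rw [coords, normRep_affine]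
    funext j
    simp [affineMatrix]
  open_source := isOpen_chartSource e
  open_target := isOpen_univ
  continuousOn_toFun := by
    refine continuousOn_pi.2 fun k => ?_
    exact (continuous_apply (e (Sum.inr k))).comp_continuousOn (continuousOn_normRep e)
  continuousOn_invFun := by
    refine Continuous.continuousOn ?_
    refine isQuotientMap_mk.continuous.comp (Continuous.subtype_mk ?_ _)
    refine continuous_pi fun i => ?_
    unfold affineMatrix
    rcases e.symm i with a | k
    · exact continuous_const
    · exact continuous_apply k

theorem exists_rows (A : FullRank r N) :
    ∃ e : Fin r ⊕ Fin (N - r) ≃ Fin N, (topBlock e A.1).det ≠ 0 := by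
  have hr : Module.finrank ℂ (Submodule.span ℂ (range A.1.row)) = r := by
    rw [← Matrix.rank_eq_finrank_span_row]; exact A.2
  obtain ⟨f, hf, -, hli⟩ := Submodule.exists_fun_fin_finrank_span_eq ℂ (range A.1.row)
  obtain ⟨f, hf, hli⟩ : ∃ f : Fin r → (Fin r → ℂ), (∀ i, f i ∈ range A.1.row) ∧
      LinearIndependent ℂ f :=
    ⟨fun i => f (finCongr hr.symm i), fun i => hf _, hli.comp _ (finCongr hr.symm).injective⟩
  choose k hk using hf
  have hkinj : Function.Injective k := by
    intro i j hij
    apply hli.injective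
    rw [← hk, ← hk, hij]
  have hrN : r ≤ N := by simpa using Fintype.card_le_of_injective k hkinj
  have hcard : Fintype.card (Fin (N - r)) = Fintype.card ((range k)ᶜ : Set (Fin N)) := by
    rw [Fintype.card_compl_set, Set.card_range_of_injective hkinj]
    simp
  let e : Fin r ⊕ Fin (N - r) ≃ Fin N :=
    (Equiv.sumCongr (Equiv.ofInjective k hkinj) (Fintype.equivOfCardEq hcard)).trans
      (Equiv.Set.sumCompl (range k))
  refine ⟨e, ?_⟩
  have : LinearIndependent ℂ (topBlock e A.1).row := by
    convert hli using 1
    funext i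
    rw [← hk]
    rfl
  exact isUnit_iff_ne_zero.1
    ((Matrix.isUnit_iff_isUnit_det _).1 (Matrix.linearIndependent_rows_iff_isUnit.1 this))

theorem exists_chart (p : Gr r N) : ∃ e : Fin r ⊕ Fin (N - r) ≃ Fin N, p ∈ chartSource e := by
  obtain ⟨A, rfl⟩ := exists_rep p
  obtain ⟨e, he⟩ := exists_rows A
  exact ⟨e, (mk_mem_chartSource e A).2 he⟩

/-- A choice of rows whose affine chart contains `p`. -/
def rowsAt (p : Gr r N) : Fin r ⊕ Fin (N - r) ≃ Fin N := (exists_chart p).choose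

theorem mem_rowsAt (p : Gr r N) : p ∈ chartSource (rowsAt p) := (exists_chart p).choose_spec

instance : ChartedSpace (Fin (N - r) → Fin r → ℂ) (Gr r N) where
  atlas := range affineChart
  chartAt p := affineChart (rowsAt p)
  mem_chart_source := mem_rowsAt
  chart_mem_atlas _ := mem_range_self _

theorem contDiffOn_det {X : Type*} [NormedAddCommGroup X] [NormedSpace ℂ X] {m : ℕ}
    {s : Set X} {f : X → Matrix (Fin m) (Fin m) ℂ}
    (hf : ∀ i j, ContDiffOn ℂ ω (fun x => f x i j) s) : ContDiffOn ℂ ω (fun x => (f x).det) s := by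
  simp only [Matrix.det_apply']
  refine ContDiffOn.sum fun σ _ => ContDiffOn.mul contDiffOn_const ?_
  exact contDiffOn_prod fun i _ => hf _ _

theorem contDiffOn_inv {X : Type*} [NormedAddCommGroup X] [NormedSpace ℂ X] {m : ℕ}
    {s : Set X} {f : X → Matrix (Fin m) (Fin m) ℂ}
    (hf : ∀ i j, ContDiffOn ℂ ω (fun x => f x i j) s) (h0 : ∀ x ∈ s, (f x).det ≠ 0) (i j : Fin m) :
    ContDiffOn ℂ ω (fun x => (f x)⁻¹ i j) s := by
  simp only [Matrix.inv_def, Ring.inverse_eq_inv', Matrix.smul_apply, smul_eq_mul,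
    Matrix.adjugate_apply]
  refine ContDiffOn.mul ((contDiffOn_det hf).inv h0) (contDiffOn_det fun a b => ?_)
  by_cases h : a = j
  · subst h; simpa using contDiffOn_const
  · simpa [Matrix.updateRow_ne h] using hf a b

theorem contDiff_affineMatrix (e : Fin r ⊕ Fin (N - r) ≃ Fin N) (i : Fin N) (j : Fin r) :
    ContDiff ℂ ω (fun B : Fin (N - r) → Fin r → ℂ => affineMatrix e B i j) := by
  unfold affineMatrix
  rcases e.symm i with a | k
  · exact contDiff_const
  · exact contDiff_apply_apply ℂ ℂ k j

theorem contDiffOn_normRep_affine (e e' : Fin r ⊕ Fin (N - r) ≃ Fin N) (i : Fin N) (j : Fin r) :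
    ContDiffOn ℂ ω (fun B => normRep e' (mk (affineFullRank e B)) i j)
      {B | mk (affineFullRank e B) ∈ chartSource e'} := by
  have : ∀ B, normRep e' (mk (affineFullRank e B)) i j
      = ∑ k, affineMatrix e B i k * (topBlock e' (affineMatrix e B))⁻¹ k j := fun B => rfl
  simp only [this]
  refine ContDiffOn.sum fun k _ => ContDiffOn.mul (contDiff_affineMatrix e i k).contDiffOn ?_
  refine contDiffOn_inv (fun a b => (contDiff_affineMatrix e _ _).contDiffOn) ?_ k j
  intro B hB
  exact (mk_mem_chartSource e' _).1 hB

/-- The affine charts make `G(r, N)` a complex manifold. -/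
instance : IsManifold 𝓘(ℂ, Fin (N - r) → Fin r → ℂ) ω (Gr r N) := by
  refine isManifold_of_contDiffOn _ _ _ ?_
  rintro _ _ ⟨e, rfl⟩ ⟨e', rfl⟩
  have h : ContDiffOn ℂ ω (fun B => coords e' (mk (affineFullRank e B)))
      {B | mk (affineFullRank e B) ∈ chartSource e'} := by
    refine contDiffOn_pi.2 fun k => contDiffOn_pi.2 fun j => ?_
    exact contDiffOn_normRep_affine e e' _ j
  refine h.mono ?_
  intro B hB
  simpa [affineChart] using hB

/-! ### The tautological bundle and its dual, the quotient bundle -/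

/-- The fibre over `[A]` of the tautological bundle `𝒯 → G(r, N)`: the column space of `A`. -/
def taut : Gr r N → Submodule ℂ (EuclideanSpace ℂ (Fin N)) :=
  Quotient.lift (fun A : FullRank r N => LinearMap.range (Matrix.toEuclideanLin A.1)) (by
    rintro A B ⟨g, hg⟩
    have hB : B.1 = A.1 * g.1 := hg
    have hA : A.1 = B.1 * (g⁻¹).1 := by rw [hB, Matrix.mul_assoc, ← Units.val_mul]; simp
    have key : ∀ (X Y : Matrix (Fin N) (Fin r) ℂ) (k : Matrix (Fin r) (Fin r) ℂ), Y = X * k →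
        LinearMap.range (Matrix.toEuclideanLin Y) ≤ LinearMap.range (Matrix.toEuclideanLin X) := by
      rintro X _ k rfl _ ⟨c, rfl⟩
      refine ⟨Matrix.toEuclideanLin k c, ?_⟩
      simp [Matrix.toLpLin_apply, Matrix.mulVec_mulVec]
    exact le_antisymm (key _ _ _ hA) (key _ _ _ hB))

theorem taut_mk (A : FullRank r N) :
    taut (mk A) = LinearMap.range (Matrix.toEuclideanLin A.1) := rfl

/-- The fibre over `p` of the bundle `𝒬 = 𝒯*`. -/
def Q (p : Gr r N) : Type := StrongDual ℂ (taut p)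

instance (p : Gr r N) : AddCommGroup (Q p) := inferInstanceAs (AddCommGroup (StrongDual ℂ (taut p)))
instance (p : Gr r N) : Module ℂ (Q p) := inferInstanceAs (Module ℂ (StrongDual ℂ (taut p)))
instance (p : Gr r N) : TopologicalSpace (Q p) :=
  inferInstanceAs (TopologicalSpace (StrongDual ℂ (taut p)))
instance (p : Gr r N) : IsTopologicalAddGroup (Q p) :=
  inferInstanceAs (IsTopologicalAddGroup (StrongDual ℂ (taut p)))
instance (p : Gr r N) : ContinuousSMul ℂ (Q p) :=
  inferInstanceAs (ContinuousSMul ℂ (StrongDual ℂ (taut p)))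
instance (p : Gr r N) : T2Space (Q p) :=
  inferInstanceAs (T2Space (StrongDual ℂ (taut p)))

/-- The columns of the normalized representative, as elements of the tautological fibre. Over
`chartSource e` they form a frame of `𝒯`. -/
def tautFrame (e : Fin r ⊕ Fin (N - r) ≃ Fin N) (p : Gr r N) (a : Fin r) : taut p :=
  ⟨WithLp.toLp 2 fun i => normRep e p i a, by
    obtain ⟨A, rfl⟩ := exists_rep p
    refine ⟨WithLp.toLp 2 fun k => (topBlock e A.1)⁻¹ k a, ?_⟩
    rfl⟩

/-- The coordinates of an element of `𝒬` in the frame dual to `tautFrame e`. -/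
def qCoord (e : Fin r ⊕ Fin (N - r) ≃ Fin N) (p : Gr r N) (φ : Q p) : Fin r → ℂ :=
  fun a => (show StrongDual ℂ (taut p) from φ) (tautFrame e p a)

/-- The element of `𝒬` with given coordinates in the frame dual to `tautFrame e`. -/
def qOfCoord (e : Fin r ⊕ Fin (N - r) ≃ Fin N) (p : Gr r N) (d : Fin r → ℂ) : Q p :=
  LinearMap.toContinuousLinearMap
    ({ toFun := fun t => ∑ a, d a * t.1 (e (Sum.inl a))
       map_add' := fun t u => by simp [mul_add, Finset.sum_add_distrib]
       map_smul' := fun c t => by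
        simp only [Submodule.coe_smul, PiLp.smul_apply, smul_eq_mul, Finset.mul_sum,
          RingHom.id_apply]
        exact Finset.sum_congr rfl fun _ _ => by ring } : taut p →ₗ[ℂ] ℂ)

theorem qOfCoord_apply (e : Fin r ⊕ Fin (N - r) ≃ Fin N) (p : Gr r N) (d : Fin r → ℂ)
    (t : taut p) : (show StrongDual ℂ (taut p) from qOfCoord e p d) t
      = ∑ a, d a * t.1 (e (Sum.inl a)) := rfl

theorem taut_eq_sum (e : Fin r ⊕ Fin (N - r) ≃ Fin N) {p : Gr r N} (hp : p ∈ chartSource e)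
    (t : taut p) : t = ∑ a, t.1 (e (Sum.inl a)) • tautFrame e p a := by
  obtain ⟨A, rfl⟩ := exists_rep p
  obtain ⟨t, c, rfl⟩ := t
  apply Subtype.ext
  rw [mk_mem_chartSource] at hp
  have hc : c.ofLp = (topBlock e A.1)⁻¹ *ᵥ (topBlock e A.1 *ᵥ c.ofLp) := by
    rw [Matrix.mulVec_mulVec, Matrix.nonsing_inv_mul _ (isUnit_iff_ne_zero.2 hp),
      Matrix.one_mulVec]
  have h2 : A.1 *ᵥ c.ofLp = normRep e (mk A) *ᵥ (topBlock e A.1 *ᵥ c.ofLp) := by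
    conv_lhs => rw [hc]
    rw [normRep_mk, ← Matrix.mulVec_mulVec]
  ext i
  have h3 := congrFun h2 i
  simp only [Submodule.coe_sum, Submodule.coe_smul, WithLp.ofLp_sum, Finset.sum_apply,
    PiLp.smul_apply, tautFrame, smul_eq_mul]
  refine h3.trans ?_
  simp only [Matrix.mulVec, dotProduct]
  refine Finset.sum_congr rfl fun a _ => ?_
  rw [mul_comm]
  rfl

theorem qOfCoord_qCoord (e : Fin r ⊕ Fin (N - r) ≃ Fin N) {p : Gr r N} (hp : p ∈ chartSource e)
    (φ : Q p) : qOfCoord e p (qCoord e p φ) = φ := by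
  refine ContinuousLinearMap.ext (f := (show StrongDual ℂ (taut p) from _)) fun t => ?_
  have key : ∀ ψ : StrongDual ℂ (taut p),
      ∑ a, ψ (tautFrame e p a) * t.1 (e (Sum.inl a)) = ψ t := by
    intro ψ
    conv_rhs => rw [taut_eq_sum e hp t]
    rw [map_sum]
    refine Finset.sum_congr rfl fun a _ => ?_
    rw [map_smul, smul_eq_mul, mul_comm]
  exact key φ

theorem qCoord_qOfCoord' (e e' : Fin r ⊕ Fin (N - r) ≃ Fin N) (p : Gr r N) (d : Fin r → ℂ)
    (a : Fin r) : qCoord e' p (qOfCoord e p d) a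
      = ∑ b, d b * normRep e' p (e (Sum.inl b)) a := rfl

theorem qCoord_qOfCoord (e : Fin r ⊕ Fin (N - r) ≃ Fin N) {p : Gr r N} (hp : p ∈ chartSource e)
    (d : Fin r → ℂ) : qCoord e p (qOfCoord e p d) = d := by
  funext a
  rw [qCoord_qOfCoord']
  have : ∀ b, normRep e p (e (Sum.inl b)) a = (1 : Matrix (Fin r) (Fin r) ℂ) b a := by
    intro b
    have h : topBlock e (normRep e p) = 1 := hp
    rw [← h]; rfl
  simp [this, Matrix.one_apply]

theorem isLinearMap_qCoord (e : Fin r ⊕ Fin (N - r) ≃ Fin N) (p : Gr r N) :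
    IsLinearMap ℂ (qCoord e p) := ⟨fun _ _ => rfl, fun _ _ => rfl⟩

/-- The trivialization of `𝒬` over an affine chart by the frame dual to `tautFrame e`. -/
def qPretriv (e : Fin r ⊕ Fin (N - r) ≃ Fin N) :
    Pretrivialization (Fin r → ℂ) (TotalSpace.proj : TotalSpace (Fin r → ℂ) (Q (N := N)) → Gr r N)
    where
  toFun z := (z.1, qCoord e z.1 z.2)
  invFun w := ⟨w.1, qOfCoord e w.1 w.2⟩
  source := TotalSpace.proj ⁻¹' chartSource e
  target := chartSource e ×ˢ univ
  map_source' := fun _ hz => ⟨hz, mem_univ _⟩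
  map_target' := fun _ hw => hw.1
  left_inv' := by
    rintro ⟨p, φ⟩ hp
    have := qOfCoord_qCoord e hp φ
    simp only [this]
  right_inv' := by
    rintro ⟨p, d⟩ ⟨hp, -⟩
    have := qCoord_qOfCoord e hp d
    simp only [this]
  open_target := (isOpen_chartSource e).prod isOpen_univ
  baseSet := chartSource e
  open_baseSet := isOpen_chartSource e
  source_eq := rfl
  target_eq := rfl
  proj_toFun := fun _ _ => rfl

theorem qPretriv_symm (e : Fin r ⊕ Fin (N - r) ≃ Fin N) {p : Gr r N} (hp : p ∈ chartSource e)
    (d : Fin r → ℂ) : (qPretriv e).symm p d = qOfCoord e p d := by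
  have h := (qPretriv e).symm_apply_apply_mk (b := p) hp (qOfCoord e p d)
  have h2 : ((qPretriv e) ⟨p, qOfCoord e p d⟩).2 = d := qCoord_qOfCoord e hp d
  rw [h2] at h
  exact h

/-- The coordinate change of `𝒬` between two of these trivializations. -/
def qCoordChange (e e' : Fin r ⊕ Fin (N - r) ≃ Fin N) (p : Gr r N) :
    (Fin r → ℂ) →L[ℂ] (Fin r → ℂ) :=
  ∑ a, ∑ b, normRep e' p (e (Sum.inl b)) a •
    (ContinuousLinearMap.proj (R := ℂ) (φ := fun _ : Fin r => ℂ) b).smulRight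
      (Pi.single a (1 : ℂ) : Fin r → ℂ)

theorem qCoordChange_apply (e e' : Fin r ⊕ Fin (N - r) ≃ Fin N) {p : Gr r N}
    (hp : p ∈ chartSource e) (d : Fin r → ℂ) :
    qCoordChange e e' p d = ((qPretriv e') ⟨p, (qPretriv e).symm p d⟩).2 := by
  rw [qPretriv_symm e hp]
  change _ = qCoord e' p (qOfCoord e p d)
  funext a
  rw [qCoord_qOfCoord']
  simp [qCoordChange, Finset.sum_apply, Pi.single_apply, mul_comm]

theorem contMDiffOn_normRep (e : Fin r ⊕ Fin (N - r) ≃ Fin N) (i : Fin N) (j : Fin r) :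
    ContMDiffOn 𝓘(ℂ, Fin (N - r) → Fin r → ℂ) 𝓘(ℂ, ℂ) ω (fun p : Gr r N => normRep e p i j)
      (chartSource e) := by
  have h1 : ContMDiffOn 𝓘(ℂ, Fin (N - r) → Fin r → ℂ) 𝓘(ℂ, Fin (N - r) → Fin r → ℂ) ω
      (affineChart e : Gr r N → _) (chartSource e) :=
    contMDiffOn_of_mem_maximalAtlas (IsManifold.subset_maximalAtlas (mem_range_self e))
  have h2 := ((contDiff_affineMatrix e i j).contMDiff).comp_contMDiffOn h1
  refine h2.congr fun p hp => ?_
  exact congrFun (congrFun (affineMatrix_coords e hp).symm i) j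

theorem contMDiffOn_qCoordChange (e e' : Fin r ⊕ Fin (N - r) ≃ Fin N) :
    ContMDiffOn 𝓘(ℂ, Fin (N - r) → Fin r → ℂ) 𝓘(ℂ, (Fin r → ℂ) →L[ℂ] (Fin r → ℂ)) ω
      (qCoordChange e e') (chartSource e ∩ chartSource e' : Set (Gr r N)) := by
  unfold qCoordChange
  refine contMDiffOn_finsetSum fun a _ => contMDiffOn_finsetSum fun b _ => ?_
  exact ((contMDiffOn_normRep e' _ a).mono inter_subset_right).smul contMDiffOn_const

theorem isInducing_qCoord (e : Fin r ⊕ Fin (N - r) ≃ Fin N) {p : Gr r N}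
    (hp : p ∈ chartSource e) : IsInducing (qCoord e p) := by
  let L : Q p ≃ₗ[ℂ] (Fin r → ℂ) :=
    { toFun := qCoord e p
      invFun := qOfCoord e p
      map_add' := fun _ _ => rfl
      map_smul' := fun _ _ => rfl
      left_inv := qOfCoord_qCoord e hp
      right_inv := qCoord_qOfCoord e hp }
  have : FiniteDimensional ℂ (Q p) := L.symm.finiteDimensional
  exact L.toContinuousLinearEquiv.toHomeomorph.isInducing

/-- The holomorphic vector bundle structure of `𝒬`. -/
def qPrebundle (r N : ℕ) : VectorPrebundle ℂ (Fin r → ℂ) (Q (r := r) (N := N)) where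
  pretrivializationAtlas := range qPretriv
  pretrivialization_linear' := by
    rintro _ ⟨e, rfl⟩
    exact ⟨fun p _ => isLinearMap_qCoord e p⟩
  pretrivializationAt p := qPretriv (rowsAt p)
  mem_base_pretrivializationAt := mem_rowsAt
  pretrivialization_mem_atlas _ := mem_range_self _
  exists_coordChange := by
    rintro _ ⟨e, rfl⟩ _ ⟨e', rfl⟩
    exact ⟨qCoordChange e e', (contMDiffOn_qCoordChange e e').continuousOn,
      fun p hp d => qCoordChange_apply e e' hp.1 d⟩
  totalSpaceMk_isInducing p := by
    have h := (isInducing_const_prod (x := p)).2 (isInducing_qCoord (rowsAt p) (mem_rowsAt p))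
    exact h

instance : TopologicalSpace (TotalSpace (Fin r → ℂ) (Q (r := r) (N := N))) :=
  (qPrebundle r N).totalSpaceTopology

instance : FiberBundle (Fin r → ℂ) (Q (r := r) (N := N)) := (qPrebundle r N).toFiberBundle

instance : VectorBundle ℂ (Fin r → ℂ) (Q (r := r) (N := N)) := (qPrebundle r N).toVectorBundle

instance : (qPrebundle r N).IsContMDiff 𝓘(ℂ, Fin (N - r) → Fin r → ℂ) ω where
  exists_contMDiffCoordChange := by
    rintro _ ⟨e, rfl⟩ _ ⟨e', rfl⟩
    exact ⟨qCoordChange e e', contMDiffOn_qCoordChange e e',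
      fun p hp d => qCoordChange_apply e e' hp.1 d⟩

instance : ContMDiffVectorBundle ω (Fin r → ℂ) (Q (r := r) (N := N))
    𝓘(ℂ, Fin (N - r) → Fin r → ℂ) :=
  (qPrebundle r N).contMDiffVectorBundle 𝓘(ℂ, Fin (N - r) → Fin r → ℂ)

/-- The metric `h_Gr = h₀*` on `𝒬 = 𝒯*`, dual to the flat metric `h₀(v, w) = w* v` on `𝒯`:
if `φ = h₀(·, a)` and `ψ = h₀(·, b)`, then `h_Gr(φ, ψ) = h₀(b, a) = a* b`. -/
def metric (p : Gr r N) (φ ψ : Q p) : ℂ :=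
  inner ℂ ((InnerProductSpace.toDual ℂ (taut p)).symm φ)
    ((InnerProductSpace.toDual ℂ (taut p)).symm ψ)

theorem injective_of_fullRank (A : FullRank r N) :
    Function.Injective (Matrix.toEuclideanLin A.1) := by
  rw [← LinearMap.ker_eq_bot, ← Submodule.finrank_eq_zero (R := ℂ)]
  have h1 := LinearMap.finrank_range_add_finrank_ker (Matrix.toEuclideanLin A.1)
  have h2 := Matrix.rank_eq_finrank_range_toLin A.1 (EuclideanSpace.basisFun (Fin N) ℂ).toBasis
    (EuclideanSpace.basisFun (Fin r) ℂ).toBasis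
  rw [← Matrix.toEuclideanLin_eq_toLin_orthonormal, A.2] at h2
  rw [← h2] at h1
  simpa using h1

/-- For a matrix `A` of rank `r`, the columns of `A` are a basis of the fibre of `𝒯` over `[A]`;
this is the element of `𝒬` with coordinates `d` in the dual basis, `A c ↦ ∑ₐ dₐ cₐ`. -/
def qOfFrame (A : FullRank r N) (d : Fin r → ℂ) : Q (mk A) :=
  LinearMap.toContinuousLinearMap
    ((∑ a, d a • (EuclideanSpace.proj a : EuclideanSpace ℂ (Fin r) →L[ℂ] ℂ).toLinearMap) ∘ₗ
      (LinearEquiv.ofInjective _ (injective_of_fullRank A)).symm.toLinearMap :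
        taut (mk A) →ₗ[ℂ] ℂ)

/-- The unitary transformation `[A] ↦ [U A]` of `G(r, N)`. -/
def unitaryMap (U : Matrix.unitaryGroup (Fin N) ℂ) : Gr r N → Gr r N :=
  Quotient.lift
    (fun A : FullRank r N => mk ⟨U.1 * A.1, by
      rw [Matrix.rank_mul_eq_right_of_isUnit_det _ _ (Matrix.UnitaryGroup.det_isUnit U), A.2]⟩)
    (by
      rintro A B ⟨g, hg⟩
      exact Quotient.sound ⟨g, by
        change U.1 * B.1 = U.1 * A.1 * g.1
        rw [Matrix.mul_assoc, ← hg]⟩)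

end Gr

/-! ### Complex differential forms in coordinates -/

section Forms

variable {V : Type*} [NormedAddCommGroup V] [NormedSpace ℂ V]

/-- The derivative of `u` at `y` in the real direction `v`. -/
def dirDeriv {W : Type*} [NormedAddCommGroup W] [NormedSpace ℝ W] (u : V → W) (v y : V) : W :=
  deriv (fun t : ℝ => u (y + (t : ℂ) • v)) 0

/-- `∂_v u = ∑ⱼ vⱼ ∂u/∂zⱼ`. -/
def dz (u : V → ℂ) (v y : V) : ℂ :=
  (1 / 2) * (dirDeriv u v y - Complex.I * dirDeriv u (Complex.I • v) y)

/-- `∂̄_v u = ∑ⱼ v̄ⱼ ∂u/∂z̄ⱼ`. -/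
def dzbar (u : V → ℂ) (v y : V) : ℂ :=
  (1 / 2) * (dirDeriv u v y + Complex.I * dirDeriv u (Complex.I • v) y)

/-- The 2-form `∂∂̄u = ∑ ∂²u/∂zⱼ∂z̄ₖ dzⱼ ∧ dz̄ₖ` at `y`, evaluated on `(v, w)`. -/
def ddbar (u : V → ℂ) (y v w : V) : ℂ :=
  dz (dzbar u w) v y - dz (dzbar u v) w y

variable {M : Type*} [TopologicalSpace M] [ChartedSpace V M]

/-- The expression of a 2-form in the chart around `x₀`. -/
def localForm (η : ∀ x : M, TangentSpace 𝓘(ℂ, V) x → TangentSpace 𝓘(ℂ, V) x → ℝ) (x₀ : M)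
    (y u v : V) : ℝ :=
  η ((chartAt V x₀).symm y) (mfderiv 𝓘(ℂ, V) 𝓘(ℂ, V) (chartAt V x₀).symm y u)
    (mfderiv 𝓘(ℂ, V) 𝓘(ℂ, V) (chartAt V x₀).symm y v)

end Forms

/-- A Kähler form on an `n`-dimensional complex manifold: a smooth closed positive real
`(1,1)`-form. -/
structure KaehlerForm (n : ℕ) (M : Type*) [TopologicalSpace M] [ChartedSpace (Fin n → ℂ) M] where
  toFun : ∀ x : M, TangentSpace 𝓘(ℂ, Fin n → ℂ) x → TangentSpace 𝓘(ℂ, Fin n → ℂ) x → ℝ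
  add_left : ∀ x u v w, toFun x (u + v) w = toFun x u w + toFun x v w
  smul_left : ∀ x (c : ℝ) v w, toFun x ((c : ℂ) • v) w = c * toFun x v w
  antisymm : ∀ x v w, toFun x v w = -toFun x w v
  map_I : ∀ x v w, toFun x (Complex.I • v) (Complex.I • w) = toFun x v w
  pos : ∀ x v, v ≠ 0 → 0 < toFun x v (Complex.I • v)
  smooth : ∀ (x₀ : M) (u v : Fin n → ℂ),
    ContDiffOn ℝ ∞ (fun y => localForm toFun x₀ y u v) (chartAt (Fin n → ℂ) x₀).target
  /-- `dω = 0`, written out on constant vector fields in charts. -/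
  closed : ∀ (x₀ : M), ∀ y ∈ (chartAt (Fin n → ℂ) x₀).target, ∀ u v w : Fin n → ℂ,
    dirDeriv (fun z => localForm toFun x₀ z v w) u y
      + dirDeriv (fun z => localForm toFun x₀ z w u) v y
      + dirDeriv (fun z => localForm toFun x₀ z u v) w y = 0

/-! ### Integration of functions against the Liouville volume form -/

section Volume

variable {n : ℕ} {M : Type*} [TopologicalSpace M] [ChartedSpace (Fin n → ℂ) M]

/-- The real basis `∂/∂x₁, ∂/∂y₁, …, ∂/∂xₙ, ∂/∂yₙ` of `ℂⁿ`. -/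
def realBasis (n : ℕ) (i : Fin n × Fin 2) : Fin n → ℂ :=
  Pi.single i.1 (if i.2 = 0 then 1 else Complex.I)

/-- The coefficient of `ωⁿ / n!` with respect to `dx₁ ∧ dy₁ ∧ ⋯ ∧ dxₙ ∧ dyₙ` in the chart around
`x₀`, where `ωⁿ (v₁, …, v₂ₙ) = 2⁻ⁿ ∑_σ sgn σ ∏ᵢ ω (v_σ(2i-1), v_σ(2i))`. -/
def volDensity (Ω : KaehlerForm n M) (x₀ : M) (y : Fin n → ℂ) : ℝ :=
  (1 / (n.factorial : ℝ)) * ((1 / 2 ^ n) * ∑ σ : Equiv.Perm (Fin n × Fin 2),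
    ((Equiv.Perm.sign σ : ℤ) : ℝ) * ∏ i : Fin n,
      localForm Ω.toFun x₀ y (realBasis n (σ (i, 0))) (realBasis n (σ (i, 1))))

theorem exists_partition (n : ℕ) (M : Type*) [TopologicalSpace M] [ChartedSpace (Fin n → ℂ) M]
    [CompactSpace M] [T2Space M] :
    ∃ ρ : PartitionOfUnity M M, ρ.IsSubordinate fun x => (chartAt (Fin n → ℂ) x).source :=
  PartitionOfUnity.exists_isSubordinate isClosed_univ _ (fun x => (chartAt _ x).open_source)
    fun x _ => mem_iUnion.2 ⟨x, mem_chart_source _ x⟩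

variable [CompactSpace M] [T2Space M]

/-- A partition of unity subordinate to the coordinate neighbourhoods. -/
def partition (n : ℕ) (M : Type*) [TopologicalSpace M] [ChartedSpace (Fin n → ℂ) M]
    [CompactSpace M] [T2Space M] : PartitionOfUnity M M := (exists_partition n M).choose

/-- `∫_M f ωⁿ / n!`, for a continuous function `f` on a compact manifold. -/
def volIntegral (Ω : KaehlerForm n M) (f : M → ℂ) : ℂ :=
  ∑ᶠ x₀ : M, ∫ y in (chartAt (Fin n → ℂ) x₀).target,
    (partition n M x₀ ((chartAt (Fin n → ℂ) x₀).symm y) : ℂ) *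
      f ((chartAt (Fin n → ℂ) x₀).symm y) * (volDensity Ω x₀ y : ℂ)

end Volume

/-! ### Hermitian metrics on holomorphic vector bundles -/

section Bundles

variable {V : Type*} [NormedAddCommGroup V] [NormedSpace ℂ V]
  {M : Type*} [TopologicalSpace M] [ChartedSpace V M] {r : ℕ}
  {E : M → Type*} [∀ x, AddCommGroup (E x)] [∀ x, Module ℂ (E x)] [∀ x, TopologicalSpace (E x)]
  [TopologicalSpace (TotalSpace (Fin r → ℂ) E)] [FiberBundle (Fin r → ℂ) E]

/-- The matrix `h(σ_a, σ_b)` at `x`, for the local holomorphic frame `σ` of `E` given by the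
trivialization around `x₀`. -/
def gram (h : ∀ x, E x → E x → ℂ) (x₀ x : M) : Matrix (Fin r) (Fin r) ℂ :=
  Matrix.of fun a b => h x ((trivializationAt (Fin r → ℂ) E x₀).symm x (Pi.single a 1))
    ((trivializationAt (Fin r → ℂ) E x₀).symm x (Pi.single b 1))

/-- The Ricci form `Ric(h) = -(i/2) ∂∂̄ log det (h(σ_a, σ_b))` of a Hermitian metric `h`. -/
def ricci (r : ℕ) {E : M → Type*} [∀ x, AddCommGroup (E x)] [∀ x, Module ℂ (E x)]
    [∀ x, TopologicalSpace (E x)] [TopologicalSpace (TotalSpace (Fin r → ℂ) E)]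
    [FiberBundle (Fin r → ℂ) E] (h : ∀ x, E x → E x → ℂ) (x : M)
    (v w : TangentSpace 𝓘(ℂ, V) x) : ℂ :=
  -(Complex.I / 2) *
    ddbar (fun y : V => (Real.log (gram (r := r) h x ((chartAt V x).symm y)).det.re : ℂ))
      (chartAt V x x) (mfderiv 𝓘(ℂ, V) 𝓘(ℂ, V) (chartAt V x) x v)
      (mfderiv 𝓘(ℂ, V) 𝓘(ℂ, V) (chartAt V x) x w)

end Bundles

/-- The standard Kähler form `ω_Gr = Ric(h_Gr)` of `G(r, N)`. -/
def Gr.kaehlerForm {r N : ℕ} (p : Gr r N)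
    (v w : TangentSpace 𝓘(ℂ, Fin (N - r) → Fin r → ℂ) p) : ℂ :=
  ricci r (Gr.metric (r := r) (N := N)) p v w

/-- A smooth Hermitian metric on a vector bundle `E` of rank `r` over a complex manifold. -/
structure HermitianMetric (n r : ℕ) {M : Type*} [TopologicalSpace M]
    [ChartedSpace (Fin n → ℂ) M] (E : M → Type*) [∀ x, AddCommGroup (E x)]
    [∀ x, Module ℂ (E x)] [∀ x, TopologicalSpace (E x)]
    [TopologicalSpace (TotalSpace (Fin r → ℂ) E)] [FiberBundle (Fin r → ℂ) E] where
  toFun : ∀ x, E x → E x → ℂ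
  add_left : ∀ x u v w, toFun x (u + v) w = toFun x u w + toFun x v w
  smul_left : ∀ x (c : ℂ) v w, toFun x (c • v) w = c * toFun x v w
  conj_symm : ∀ x v w, toFun x v w = (starRingEnd ℂ) (toFun x w v)
  pos : ∀ x v, v ≠ 0 → 0 < (toFun x v v).re
  smooth : ∀ (x₀ : M) (a b : Fin r),
    ContMDiffOn 𝓘(ℝ, Fin n → ℂ) 𝓘(ℝ, ℂ) ∞ (fun x => gram toFun x₀ x a b)
      (trivializationAt (Fin r → ℂ) E x₀).baseSet

/-! ### Sections, Kodaira maps and balanced metrics -/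

/-- `H⁰(M, E)`, the space of global holomorphic sections. -/
abbrev H0 (n r : ℕ) {M : Type*} [TopologicalSpace M] [ChartedSpace (Fin n → ℂ) M]
    (E : M → Type*) [∀ x, AddCommGroup (E x)] [∀ x, Module ℂ (E x)] [∀ x, TopologicalSpace (E x)]
    [TopologicalSpace (TotalSpace (Fin r → ℂ) E)] [FiberBundle (Fin r → ℂ) E] : Type _ :=
  ContMDiffSection 𝓘(ℂ, Fin n → ℂ) (Fin r → ℂ) ω E

section Balanced

variable {n r N : ℕ} {M : Type*} [TopologicalSpace M] [ChartedSpace (Fin n → ℂ) M]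
  {E : M → Type*} [∀ x, AddCommGroup (E x)] [∀ x, Module ℂ (E x)] [∀ x, TopologicalSpace (E x)]
  [TopologicalSpace (TotalSpace (Fin r → ℂ) E)] [FiberBundle (Fin r → ℂ) E]

/-- The matrix `S(x)` with `sⱼ(x) = ∑ₐ Sⱼₐ(x) σₐ(x)`, for the local frame `σ` of `E` given by the
trivialization around `x`. -/
def sectionMatrix (s : Fin N → H0 n r E) (x : M) : Matrix (Fin N) (Fin r) ℂ :=
  Matrix.of fun j a => (trivializationAt (Fin r → ℂ) E x ⟨x, s j x⟩).2 a

/-- The sections `s₁, …, s_N` span every fibre of `E`. -/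
def Spanning (s : Fin N → H0 n r E) : Prop := ∀ x, (sectionMatrix s x).rank = r

/-- The Kodaira map `i_s : M → G(r, N)`, `x ↦ [S(x)]`. -/
def kodairaMap (s : Fin N → H0 n r E) (hs : Spanning s) (x : M) : Gr r N :=
  Gr.mk ⟨sectionMatrix s x, hs x⟩

/-- The isomorphism `E = i_s^* 𝒬`, on the fibre over `x`. -/
def kodairaFibre (s : Fin N → H0 n r E) (hs : Spanning s) (x : M) (v : E x) :
    Gr.Q (kodairaMap s hs x) :=
  Gr.qOfFrame ⟨sectionMatrix s x, hs x⟩ (trivializationAt (Fin r → ℂ) E x ⟨x, v⟩).2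

/-- Under `E = i_s^* 𝒬`, the section `sⱼ` corresponds to the `j`-th coordinate function. -/
theorem kodairaFibre_apply (s : Fin N → H0 n r E) (hs : Spanning s) (x : M) (j : Fin N)
    (t : Gr.taut (kodairaMap s hs x)) :
    (show StrongDual ℂ (Gr.taut (kodairaMap s hs x)) from kodairaFibre s hs x (s j x)) t
      = t.1 j := by
  obtain ⟨_, c, rfl⟩ := t
  have h : (LinearEquiv.ofInjective _ (Gr.injective_of_fullRank ⟨sectionMatrix s x, hs x⟩)).symm
      ⟨Matrix.toEuclideanLin (sectionMatrix s x) c, c, rfl⟩ = c := by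
    rw [LinearEquiv.symm_apply_eq]; rfl
  change (∑ a, sectionMatrix s x j a •
      (EuclideanSpace.proj a : EuclideanSpace ℂ (Fin r) →L[ℂ] ℂ).toLinearMap)
    ((LinearEquiv.ofInjective _ (Gr.injective_of_fullRank ⟨sectionMatrix s x, hs x⟩)).symm
      ⟨Matrix.toEuclideanLin (sectionMatrix s x) c, c, rfl⟩) = _
  rw [h]
  simp [Matrix.toLpLin_apply, Matrix.mulVec, dotProduct]

/-- The metric `h_s = i_s^* h_Gr` on `E = i_s^* 𝒬`. -/
def inducedMetric (s : Fin N → H0 n r E) (hs : Spanning s) (x : M) (v w : E x) : ℂ :=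
  Gr.metric (kodairaMap s hs x) (kodairaFibre s hs x v) (kodairaFibre s hs x w)

/-- The `L²`-product `(1 / V(M)) ∫_M h(s, t) ωⁿ / n!` on `H⁰(M, E)`. -/
def l2 [CompactSpace M] [T2Space M] (Ω : KaehlerForm n M) (h : ∀ x, E x → E x → ℂ)
    (s t : H0 n r E) : ℂ :=
  (1 / volIntegral Ω fun _ => 1) * volIntegral Ω fun x => h x (s x) (t x)

variable [VectorBundle ℂ (Fin r → ℂ) E]

/-- A basis `s` of `H⁰(M, E)` is `ω`-balanced if `⟨sⱼ, sₖ⟩ = (r / N) δⱼₖ` in the `L²`-product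
of `h_s`. -/
def IsBalancedBasis [CompactSpace M] [T2Space M] (Ω : KaehlerForm n M)
    (s : Module.Basis (Fin N) ℂ (H0 n r E)) (hs : Spanning s) : Prop :=
  ∀ j k, l2 Ω (inducedMetric s hs) (s j) (s k) = if j = k then (r : ℂ) / N else 0

/-- A Hermitian metric on `E` is `ω`-balanced if it is `h_s` for an `ω`-balanced basis `s`. -/
def IsBalancedMetric [CompactSpace M] [T2Space M] (Ω : KaehlerForm n M)
    (h : HermitianMetric n r E) : Prop :=
  ∃ (N : ℕ) (s : Module.Basis (Fin N) ℂ (H0 n r E)) (hs : Spanning s),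
    h.toFun = inducedMetric s hs ∧ IsBalancedBasis Ω s hs

/-- `E` is very ample: `H⁰(M, E)` is finite dimensional, it spans every fibre of `E`, and the
Kodaira map of every basis is a holomorphic embedding. -/
def IsVeryAmple (n r : ℕ) {M : Type*} [TopologicalSpace M] [ChartedSpace (Fin n → ℂ) M]
    (E : M → Type*) [∀ x, AddCommGroup (E x)] [∀ x, Module ℂ (E x)] [∀ x, TopologicalSpace (E x)]
    [TopologicalSpace (TotalSpace (Fin r → ℂ) E)] [FiberBundle (Fin r → ℂ) E]
    [VectorBundle ℂ (Fin r → ℂ) E] : Prop :=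
  FiniteDimensional ℂ (H0 n r E) ∧
    ∀ (N : ℕ) (s : Module.Basis (Fin N) ℂ (H0 n r E)), ∃ hs : Spanning s,
      Manifold.IsSmoothEmbedding 𝓘(ℂ, Fin n → ℂ) 𝓘(ℂ, Fin (N - r) → Fin r → ℂ) ω
        (kodairaMap s hs)

end Balanced

/-- Two holomorphic vector bundles of rank `r` over `M` are holomorphically isomorphic. -/
def HolomorphicIso (n r : ℕ) {M : Type*} [TopologicalSpace M] [ChartedSpace (Fin n → ℂ) M]
    (E₁ E₂ : M → Type*)
    [∀ x, AddCommMonoid (E₁ x)] [∀ x, Module ℂ (E₁ x)] [∀ x, TopologicalSpace (E₁ x)]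
    [TopologicalSpace (TotalSpace (Fin r → ℂ) E₁)] [FiberBundle (Fin r → ℂ) E₁]
    [∀ x, AddCommMonoid (E₂ x)] [∀ x, Module ℂ (E₂ x)] [∀ x, TopologicalSpace (E₂ x)]
    [TopologicalSpace (TotalSpace (Fin r → ℂ) E₂)] [FiberBundle (Fin r → ℂ) E₂] : Prop :=
  ∃ Φ : ∀ x, E₁ x ≃ₗ[ℂ] E₂ x,
    ContMDiff (𝓘(ℂ, Fin n → ℂ).prod 𝓘(ℂ, Fin r → ℂ)) (𝓘(ℂ, Fin n → ℂ).prod 𝓘(ℂ, Fin r → ℂ)) ω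
      (fun z : TotalSpace (Fin r → ℂ) E₁ => (⟨z.1, Φ z.1 z.2⟩ : TotalSpace (Fin r → ℂ) E₂))

section Maps

universe u v

variable {n r N : ℕ} {M : Type u} [TopologicalSpace M] [ChartedSpace (Fin n → ℂ) M]
  [CompactSpace M] [T2Space M]

/-- A map `f : M → G(r, N)` is `ω`-balanced if it is the Kodaira map of an `ω`-balanced basis of
`H⁰(M, E)`, for some very ample holomorphic vector bundle `E` over `M`. -/
def IsBalancedMap (Ω : KaehlerForm n M) (f : M → Gr r N) : Prop :=
  ∃ (E : M → Type v) (_ : ∀ x, AddCommGroup (E x)) (_ : ∀ x, Module ℂ (E x))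
    (_ : ∀ x, TopologicalSpace (E x)) (_ : TopologicalSpace (TotalSpace (Fin r → ℂ) E))
    (_ : FiberBundle (Fin r → ℂ) E) (_ : VectorBundle ℂ (Fin r → ℂ) E)
    (_ : ContMDiffVectorBundle ω (Fin r → ℂ) E 𝓘(ℂ, Fin n → ℂ)),
    IsVeryAmple n r E ∧
      ∃ (s : Module.Basis (Fin N) ℂ (H0 n r E)) (hs : Spanning s),
        IsBalancedBasis Ω s hs ∧ f = kodairaMap s hs

/-- `f^* ω_Gr = ω`. -/
def IsKaehlerMap (Ω : KaehlerForm n M) (f : M → Gr r N) : Prop :=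
  ∀ (x : M) (v w : TangentSpace 𝓘(ℂ, Fin n → ℂ) x),
    Gr.kaehlerForm (f x)
      (mfderiv 𝓘(ℂ, Fin n → ℂ) 𝓘(ℂ, Fin (N - r) → Fin r → ℂ) f x v)
      (mfderiv 𝓘(ℂ, Fin n → ℂ) 𝓘(ℂ, Fin (N - r) → Fin r → ℂ) f x w) = (Ω.toFun x v w : ℂ)

/-- `f` is an `ω`-balanced Kähler embedding of `M` into `G(r, N)` with `f^* 𝒬 = E`. -/
structure IsBalancedKaehlerEmbedding (Ω : KaehlerForm n M)
    (E : M → Type v) [∀ x, AddCommGroup (E x)] [∀ x, Module ℂ (E x)] [∀ x, TopologicalSpace (E x)]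
    [TopologicalSpace (TotalSpace (Fin r → ℂ) E)] [FiberBundle (Fin r → ℂ) E]
    (f : ContMDiffMap 𝓘(ℂ, Fin n → ℂ) 𝓘(ℂ, Fin (N - r) → Fin r → ℂ) M (Gr r N) ω) : Prop where
  balanced : IsBalancedMap.{u, v} Ω f
  kaehler : IsKaehlerMap Ω f
  embedding : Manifold.IsSmoothEmbedding 𝓘(ℂ, Fin n → ℂ) 𝓘(ℂ, Fin (N - r) → Fin r → ℂ) ω f
  pullback : HolomorphicIso n r (f *ᵖ (Gr.Q (r := r) (N := N))) E

end Maps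

end Balanced

end

open Balanced
open Bundle
open scoped Manifold ContDiff

universe u v

noncomputable section

namespace Balanced

open Matrix Topology Set

/-! ### Orthogonal projections onto column spaces and the defect of a linear isomorphism -/

section LinearAlgebra

variable {m k : ℕ}

/-! Let `P_x` be the orthogonal projection of `ℂᴺ` onto the column space `W_x` of the matrix of a
basis `s` at `x`. The vector representing the `j`-th coordinate function on `W_x` is `P_x e_j`, so
`h_s(s_j, s_k) = (P_x)_{jk}` (`inducedMetric_section`). Thus `s` is balanced exactly when the
average of `P_x` over `M` is `(r/N)` times the identity.

Existence. Take for `f` the Kodaira map of a balanced basis inducing `h`. It is an embedding because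
`E` is very ample, and `f^* 𝒬 = E` by matching `s_j` with the `j`-th coordinate function. In local
frames the potential of `Ric(h_s)` is the pullback of the potential of `ω_Gr` plus the logarithm of
the modulus of a nonvanishing holomorphic function. The latter is pluriharmonic, so `f^* ω_Gr =
Ric(h_s) = ω` (`kaehlerForm_kodairaMap`).

Uniqueness. If `g` is another such map, the isomorphism `g^* 𝒬 ≅ E` carries the coordinate functions
to `N` independent holomorphic sections of `E`, hence to a basis. This basis is obtained from `s` by
a constant invertible matrix `A`, and `g(x) = A W_x` (`exists_mulLeft_of_holomorphicIso`). It
remains to replace `A` by a unitary matrix.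

Let `P'_x` project onto `A W_x`, put `X = A⁻¹` and `C_x = P_x X - X P'_x`. Since `X` maps `A W_x`
into `W_x`, one finds `tr(C C*) = tr(P X X*) - tr(P' X* X)` (`trace_defect`). Both averages are the
same multiple of the identity, so the integral of the right side is a multiple of `tr(X X*) - tr(X*
X) = 0`. The left side is a nonnegative continuous function and the volume density is positive, so
`C_x = 0` for every `x`. Then `A P_x = P'_x A`, whence `A* A` commutes with `P_x`, and so does its
square root `R`. In the polar decomposition `A = U R` the factor `R` preserves every `W_x`, so `A
W_x = U W_x` with one `U` for all `x` (`exists_unitaryMap_of_balanced`). -/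

theorem FullRank.mulVec_injective (S : FullRank k m) : Function.Injective S.1.mulVec := by
  intro c d h
  have := Gr.injective_of_fullRank S (a₁ := WithLp.toLp 2 c) (a₂ := WithLp.toLp 2 d)
    (by simp [Matrix.toLpLin_apply, h])
  simpa using this

open scoped ComplexOrder in
theorem FullRank.posDef_gram (S : FullRank k m) : (S.1ᴴ * S.1).PosDef :=
  Matrix.PosDef.conjTranspose_mul_self S.1 S.mulVec_injective

open scoped ComplexOrder in
theorem FullRank.isUnit_det_gram (S : FullRank k m) : IsUnit (S.1ᴴ * S.1).det :=
  (Matrix.isUnit_iff_isUnit_det _).1 S.posDef_gram.isUnit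

/-- The orthogonal projection onto the column space of `S`. -/
def columnProj (S : Matrix (Fin m) (Fin k) ℂ) : Matrix (Fin m) (Fin m) ℂ :=
  S * (Sᴴ * S)⁻¹ * Sᴴ

theorem columnProj_mul_self (S : FullRank k m) : columnProj S.1 * S.1 = S.1 := by
  rw [columnProj, Matrix.mul_assoc, Matrix.mul_assoc, Matrix.nonsing_inv_mul _ S.isUnit_det_gram,
    Matrix.mul_one]

theorem isHermitian_columnProj (S : Matrix (Fin m) (Fin k) ℂ) : (columnProj S)ᴴ = columnProj S := by
  simp only [columnProj, Matrix.conjTranspose_mul, Matrix.conjTranspose_conjTranspose,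
    Matrix.conjTranspose_nonsing_inv, Matrix.mul_assoc]

/-- The factors `g` and `gᴴ` cancel against the inverse of the new Gram matrix. This is what lets
the projection descend to the Grassmannian. -/
theorem columnProj_mul_of_isUnit (S : Matrix (Fin m) (Fin k) ℂ) (g : Matrix (Fin k) (Fin k) ℂ)
    (hg : IsUnit g.det) : columnProj (S * g) = columnProj S := by
  have hg' : IsUnit (gᴴ).det := by rw [Matrix.det_conjTranspose]; exact hg.star
  have h1 : (S * g)ᴴ * (S * g) = gᴴ * (Sᴴ * S) * g := by
    simp only [Matrix.conjTranspose_mul, Matrix.mul_assoc]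
  rw [columnProj, h1, Matrix.mul_inv_rev, Matrix.mul_inv_rev, columnProj, Matrix.conjTranspose_mul]
  calc S * g * (g⁻¹ * ((Sᴴ * S)⁻¹ * (gᴴ)⁻¹)) * (gᴴ * Sᴴ)
      = S * (g * g⁻¹) * (Sᴴ * S)⁻¹ * ((gᴴ)⁻¹ * gᴴ) * Sᴴ := by simp only [Matrix.mul_assoc]
    _ = _ := by rw [Matrix.mul_nonsing_inv _ hg, Matrix.nonsing_inv_mul _ hg', Matrix.mul_one,
        Matrix.mul_one]

theorem columnProj_mul_columnProj (S : FullRank k m) :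
    columnProj S.1 * columnProj S.1 = columnProj S.1 := by
  calc columnProj S.1 * columnProj S.1
      = S.1 * (S.1ᴴ * S.1)⁻¹ * S.1ᴴ * (S.1 * (S.1ᴴ * S.1)⁻¹ * S.1ᴴ) := rfl
    _ = S.1 * ((S.1ᴴ * S.1)⁻¹ * (S.1ᴴ * S.1)) * (S.1ᴴ * S.1)⁻¹ * S.1ᴴ := by
        simp only [Matrix.mul_assoc]
    _ = _ := by rw [Matrix.nonsing_inv_mul _ S.isUnit_det_gram, Matrix.mul_one]; rfl

/-- The product of an invertible matrix with a matrix of full rank. -/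
def FullRank.mulLeft (A : GL (Fin m) ℂ) (S : FullRank k m) : FullRank k m :=
  ⟨A.1 * S.1, by
    rw [Matrix.rank_mul_eq_right_of_isUnit_det _ _ ((Matrix.isUnit_iff_isUnit_det _).1 A.isUnit),
      S.2]⟩

/-- The matrix `(P - A⁻¹ P' A) A⁻¹`, where `P` and `P'` are the orthogonal projections onto the
column spaces of `S` and `A S`. -/
def defect (A : GL (Fin m) ℂ) (P P' : Matrix (Fin m) (Fin m) ℂ) : Matrix (Fin m) (Fin m) ℂ :=
  (P - (A⁻¹).1 * P' * A.1) * (A⁻¹).1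

theorem defect_eq (A : GL (Fin m) ℂ) (P P' : Matrix (Fin m) (Fin m) ℂ) :
    defect A P P' = P * (A⁻¹).1 - (A⁻¹).1 * P' := by
  have h : A.1 * (A⁻¹).1 = 1 := by rw [← Units.val_mul]; simp
  rw [defect, Matrix.sub_mul, Matrix.mul_assoc _ A.1, h, Matrix.mul_one]

/-- `A⁻¹` sends the column space of `A S` into that of `S`, where the projection acts as the
identity. -/
theorem columnProj_mul_inv_mul_columnProj (A : GL (Fin m) ℂ) (S : FullRank k m) :
    columnProj S.1 * ((A⁻¹).1 * columnProj (S.mulLeft A).1)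
      = (A⁻¹).1 * columnProj (S.mulLeft A).1 := by
  have h : (A⁻¹).1 * A.1 = 1 := by rw [← Units.val_mul]; simp
  have h2 : (A⁻¹).1 * columnProj (S.mulLeft A).1
      = S.1 * (((S.mulLeft A).1ᴴ * (S.mulLeft A).1)⁻¹ * (S.mulLeft A).1ᴴ) := by
    rw [columnProj, Matrix.mul_assoc (S.mulLeft A).1]
    conv_lhs => rw [show (S.mulLeft A).1 * (((S.mulLeft A).1ᴴ * (S.mulLeft A).1)⁻¹
      * (S.mulLeft A).1ᴴ) = A.1 * (S.1 * (((S.mulLeft A).1ᴴ * (S.mulLeft A).1)⁻¹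
      * (S.mulLeft A).1ᴴ)) from Matrix.mul_assoc _ _ _]
    rw [← Matrix.mul_assoc, h, Matrix.one_mul]
  rw [h2, ← Matrix.mul_assoc, columnProj_mul_self]

/-- The identity behind the uniqueness of balanced maps. -/
theorem trace_defect (A : GL (Fin m) ℂ) (S : FullRank k m) :
    (defect A (columnProj S.1) (columnProj (S.mulLeft A).1)
        * (defect A (columnProj S.1) (columnProj (S.mulLeft A).1))ᴴ).trace
      = (columnProj S.1 * ((A⁻¹).1 * (A⁻¹).1ᴴ)).trace
        - (columnProj (S.mulLeft A).1 * ((A⁻¹).1ᴴ * (A⁻¹).1)).trace := by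
  have h1 := columnProj_mul_inv_mul_columnProj A S
  have hPP := columnProj_mul_columnProj S
  have hPP' := columnProj_mul_columnProj (S.mulLeft A)
  have hP := isHermitian_columnProj S.1
  have hP' := isHermitian_columnProj (S.mulLeft A).1
  rw [defect_eq]
  generalize columnProj S.1 = P at *
  generalize columnProj (S.mulLeft A).1 = P' at *
  generalize (A⁻¹).1 = X at *
  have h2 : P' * Xᴴ * P = P' * Xᴴ := by
    have := congrArg Matrix.conjTranspose h1
    simpa only [Matrix.conjTranspose_mul, hP, hP', Matrix.mul_assoc] using this
  -- Of the four terms of `C Cᴴ`, the first has trace `tr(P X Xᴴ)`; the other three all have trace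
  -- `tr(X P' Xᴴ)`, with signs `-`, `-`, `+`.
  have e1 : (P * X * (Xᴴ * P)).trace = (P * (X * Xᴴ)).trace := by
    rw [← Matrix.mul_assoc, Matrix.trace_mul_comm, ← Matrix.mul_assoc, ← Matrix.mul_assoc, hPP,
      Matrix.mul_assoc]
  have e2 : (P * X * (P' * Xᴴ)).trace = (X * P' * Xᴴ).trace := by
    rw [← Matrix.mul_assoc, Matrix.mul_assoc P, h1]
  have e3 : (X * P' * (Xᴴ * P)).trace = (X * P' * Xᴴ).trace := by
    rw [Matrix.mul_assoc, ← Matrix.mul_assoc P', h2, ← Matrix.mul_assoc]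
  have e4 : (X * P' * (P' * Xᴴ)).trace = (X * P' * Xᴴ).trace := by
    rw [← Matrix.mul_assoc, Matrix.mul_assoc X, hPP']
  have e5 : (X * P' * Xᴴ).trace = (P' * (Xᴴ * X)).trace := by
    rw [Matrix.mul_assoc, Matrix.trace_mul_comm, Matrix.mul_assoc]
  rw [Matrix.conjTranspose_sub, Matrix.conjTranspose_mul, Matrix.conjTranspose_mul, hP, hP',
    Matrix.sub_mul, Matrix.mul_sub, Matrix.mul_sub, Matrix.trace_sub, Matrix.trace_sub,
    Matrix.trace_sub, e1, e2, e3, e4, e5]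
  ring

/-- The squared Frobenius norm as a real number: a sum of squares whose vanishing forces `C = 0`. -/
theorem trace_mul_conjTranspose_self_eq (C : Matrix (Fin m) (Fin m) ℂ) :
    (C * Cᴴ).trace = ((∑ i, ∑ j, ‖C i j‖ ^ 2 : ℝ) : ℂ) := by
  simp only [Matrix.trace, Matrix.diag, Matrix.mul_apply, Matrix.conjTranspose_apply]
  push_cast
  refine Finset.sum_congr rfl fun i _ => Finset.sum_congr rfl fun j _ => ?_
  exact Complex.mul_conj' _

open scoped ComplexOrder MatrixOrder in
/-- An invertible matrix is a unitary matrix times an invertible matrix commuting with everything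
that commutes with `Aᴴ A`. -/
theorem exists_polar (A : GL (Fin m) ℂ) :
    ∃ (U : Matrix.unitaryGroup (Fin m) ℂ) (R : Matrix (Fin m) (Fin m) ℂ), IsUnit R ∧
      A.1 = U.1 * R ∧ ∀ P, Commute (A.1ᴴ * A.1) P → Commute R P := by
  have hpos : (A.1ᴴ * A.1).PosSemidef := Matrix.posSemidef_conjTranspose_mul_self _
  have h0 : 0 ≤ A.1ᴴ * A.1 := hpos.nonneg
  set R := CFC.sqrt (A.1ᴴ * A.1) with hR
  have hRR : R * R = A.1ᴴ * A.1 := CFC.sqrt_mul_sqrt_self _ h0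
  have hRs : Rᴴ = R := (CFC.sqrt_nonneg (A.1ᴴ * A.1)).isSelfAdjoint
  have hA : IsUnit A.1.det := (Matrix.isUnit_iff_isUnit_det _).1 A.isUnit
  have hRu : IsUnit R := by
    rw [Matrix.isUnit_iff_isUnit_det]
    have : IsUnit (R * R).det := by
      rw [hRR, Matrix.det_mul, Matrix.det_conjTranspose]
      exact hA.star.mul hA
    rw [Matrix.det_mul] at this
    exact isUnit_of_mul_isUnit_left this
  have hRd := (Matrix.isUnit_iff_isUnit_det _).1 hRu
  refine ⟨⟨A.1 * R⁻¹, ?_⟩, R, hRu, ?_, ?_⟩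
  · rw [Matrix.mem_unitaryGroup_iff', Matrix.star_eq_conjTranspose, Matrix.conjTranspose_mul,
      Matrix.conjTranspose_nonsing_inv, hRs]
    calc R⁻¹ * A.1ᴴ * (A.1 * R⁻¹) = R⁻¹ * (A.1ᴴ * A.1) * R⁻¹ := by simp only [Matrix.mul_assoc]
      _ = (R⁻¹ * R) * (R * R⁻¹) := by rw [← hRR]; simp only [Matrix.mul_assoc]
      _ = 1 := by rw [Matrix.nonsing_inv_mul _ hRd, Matrix.mul_nonsing_inv _ hRd, Matrix.mul_one]
  · change A.1 = A.1 * R⁻¹ * R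
    rw [Matrix.mul_assoc, Matrix.nonsing_inv_mul _ hRd, Matrix.mul_one]
  · intro P hP
    -- The square root is a continuous function of `Aᴴ A`, so it commutes with whatever commutes
    -- with `Aᴴ A`.
    rw [hR, CFC.sqrt_eq_cfc]
    exact hP.cfc_nnreal _

end LinearAlgebra

/-! ### The projection onto the tautological fibre and the metric of `𝒬` -/

namespace Gr

variable {r N : ℕ}

/-- The orthogonal projection of `ℂᴺ` onto the fibre of `𝒯` over `p`. -/
def proj : Gr r N → Matrix (Fin N) (Fin N) ℂ :=
  Quotient.lift (fun S : FullRank r N => columnProj S.1) (by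
    rintro S T ⟨g, hg⟩
    rw [hg, columnProj_mul_of_isUnit _ _ ((Matrix.isUnit_iff_isUnit_det _).1 g.isUnit)])

theorem proj_mk (S : FullRank r N) : proj (mk S) = columnProj S.1 := rfl

/-- On representatives the inverse Gram matrix is `det⁻¹` times the adjugate, and the determinant
never vanishes; continuity then passes to the quotient. -/
theorem continuous_proj : Continuous (proj : Gr r N → Matrix (Fin N) (Fin N) ℂ) := by
  rw [isQuotientMap_mk.continuous_iff]
  have hc : Continuous fun S : FullRank r N => S.1 := continuous_subtype_val
  have hG : Continuous fun S : FullRank r N => S.1ᴴ * S.1 := hc.matrix_conjTranspose.matrix_mul hc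
  have : (proj ∘ mk : FullRank r N → _) = fun S =>
      S.1 * ((S.1ᴴ * S.1).det⁻¹ • (S.1ᴴ * S.1).adjugate) * S.1ᴴ := by
    funext S
    change columnProj S.1 = _
    rw [columnProj, Matrix.inv_def, Ring.inverse_eq_inv']
  rw [this]
  refine (hc.matrix_mul ?_).matrix_mul hc.matrix_conjTranspose
  exact (hG.matrix_det.inv₀ fun S => S.isUnit_det_gram.ne_zero).smul hG.matrix_adjugate

/-- The `j`-th coordinate function, as an element of the fibre of `𝒬` over `p`. -/
def coordFun (p : Gr r N) (j : Fin N) : Q p :=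
  (EuclideanSpace.proj j : EuclideanSpace ℂ (Fin N) →L[ℂ] ℂ).comp (taut p).subtypeL

theorem coordFun_apply (p : Gr r N) (j : Fin N) (t : taut p) :
    (show StrongDual ℂ (taut p) from coordFun p j) t = t.1 j := rfl

theorem proj_column_mem (p : Gr r N) (j : Fin N) :
    (WithLp.toLp 2 fun i => proj p i j : EuclideanSpace ℂ (Fin N)) ∈ taut p := by
  obtain ⟨S, rfl⟩ := exists_rep p
  refine ⟨WithLp.toLp 2 fun a => ((S.1ᴴ * S.1)⁻¹ * S.1ᴴ) a j, ?_⟩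
  ext i
  simp only [Matrix.toLpLin_apply, proj_mk, columnProj, Matrix.mul_assoc]
  rfl

/-- The vector representing an element of the fibre of `𝒬` over `p`. -/
def riesz (p : Gr r N) (φ : Q p) : taut p :=
  (InnerProductSpace.toDual ℂ (taut p)).symm (show StrongDual ℂ (taut p) from φ)

theorem metric_eq_inner (p : Gr r N) (φ ψ : Q p) :
    metric p φ ψ = InnerProductSpace.toInner.inner (𝕜 := ℂ) (riesz p φ) (riesz p ψ) := rfl

theorem riesz_add (p : Gr r N) (φ ψ : Q p) : riesz p (φ + ψ) = riesz p φ + riesz p ψ :=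
  map_add (InnerProductSpace.toDual ℂ (taut p)).symm _ _

theorem riesz_smul (p : Gr r N) (c : ℂ) (φ : Q p) :
    riesz p (c • φ) = (starRingEnd ℂ) c • riesz p φ :=
  (InnerProductSpace.toDual ℂ (taut p)).symm.map_smulₛₗ c _

theorem inner_riesz (p : Gr r N) (φ : Q p) (t : taut p) :
    InnerProductSpace.toInner.inner (𝕜 := ℂ) (riesz p φ) t
      = (show StrongDual ℂ (taut p) from φ) t := by
  rw [← InnerProductSpace.toDual_apply_apply, riesz, LinearIsometryEquiv.apply_symm_apply]

/-- For `t` in the fibre, `t_j = ⟨e_j, t⟩ = ⟨P e_j, t⟩` because `P` is Hermitian and fixes `t`; and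
`P e_j` is the `j`-th column of `P`. -/
theorem riesz_coordFun (p : Gr r N) (j : Fin N) :
    riesz p (coordFun p j) = ⟨_, proj_column_mem p j⟩ := by
  refine ext_inner_right ℂ fun t => ?_
  rw [inner_riesz, coordFun_apply]
  obtain ⟨S, rfl⟩ := exists_rep p
  obtain ⟨_, c, rfl⟩ := t
  have h := congrFun (congrArg (· *ᵥ c.ofLp) (columnProj_mul_self S)) j
  simp only [← Matrix.mulVec_mulVec] at h
  rw [Submodule.coe_inner, EuclideanSpace.inner_eq_star_dotProduct]
  refine h.symm.trans ?_
  rw [dotProduct_comm]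
  change ∑ i, columnProj S.1 j i * (S.1 *ᵥ c.ofLp) i = ∑ i, star (columnProj S.1 i j) * (S.1 *ᵥ c.ofLp) i
  refine Finset.sum_congr rfl fun i _ => ?_
  exact congrArg (· * _) (congrFun (congrFun (isHermitian_columnProj S.1) j) i).symm

theorem metric_coordFun (p : Gr r N) (j k : Fin N) :
    metric p (coordFun p j) (coordFun p k) = proj p j k := by
  rw [metric_eq_inner, inner_riesz, riesz_coordFun]
  rfl

theorem metric_add_left (p : Gr r N) (φ₁ φ₂ ψ : Q p) :
    metric p (φ₁ + φ₂) ψ = metric p φ₁ ψ + metric p φ₂ ψ := by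
  simp only [metric_eq_inner, riesz_add, inner_add_left]

theorem metric_smul_left (p : Gr r N) (c : ℂ) (φ ψ : Q p) :
    metric p (c • φ) ψ = c * metric p φ ψ := by
  rw [metric_eq_inner, riesz_smul]
  refine (inner_smul_left (𝕜 := ℂ) (riesz p φ) (riesz p ψ) _).trans ?_
  rw [Complex.conj_conj]
  rfl

theorem conj_metric (p : Gr r N) (φ ψ : Q p) :
    (starRingEnd ℂ) (metric p ψ φ) = metric p φ ψ :=
  inner_conj_symm (𝕜 := ℂ) (riesz p φ) (riesz p ψ)

theorem metric_sum_smul_left (p : Gr r N) {ι : Type*} (s : Finset ι) (c : ι → ℂ)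
    (φ : ι → Q p) (χ : Q p) :
    metric p (∑ i ∈ s, c i • φ i) χ = ∑ i ∈ s, c i * metric p (φ i) χ := by
  let L : Q p →ₗ[ℂ] ℂ :=
    { toFun := fun φ => metric p φ χ
      map_add' := fun a b => metric_add_left p a b χ
      map_smul' := fun a b => metric_smul_left p a b χ }
  change L _ = ∑ i ∈ s, c i * L (φ i)
  simp [map_sum]

theorem metric_sum_smul (p : Gr r N) {ι κ : Type*} (s : Finset ι) (t : Finset κ) (c : ι → ℂ)
    (d : κ → ℂ) (φ : ι → Q p) (ψ : κ → Q p) :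
    metric p (∑ i ∈ s, c i • φ i) (∑ j ∈ t, d j • ψ j)
      = ∑ i ∈ s, ∑ j ∈ t, c i * (starRingEnd ℂ) (d j) * metric p (φ i) (ψ j) := by
  rw [metric_sum_smul_left]
  refine Finset.sum_congr rfl fun i _ => ?_
  rw [← conj_metric, metric_sum_smul_left, map_sum, Finset.mul_sum]
  refine Finset.sum_congr rfl fun j _ => ?_
  rw [map_mul, conj_metric, mul_assoc]

/-- The Gram matrix of a frame `σ` of `𝒬` in terms of the coordinates of the coordinate
functions. -/
theorem metric_frame (S : FullRank r N) (σ : Fin r → Q (mk S))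
    (h : ∀ j, coordFun (mk S) j = ∑ a, S.1 j a • σ a) :
    Matrix.of (fun a b => metric (mk S) (σ a) (σ b)) = (S.1ᴴ * S.1)⁻¹ := by
  set G : Matrix (Fin r) (Fin r) ℂ := Matrix.of fun a b => metric (mk S) (σ a) (σ b) with hG
  -- Both sides are the Gram matrix of the coordinate functions, the right side after expansion in
  -- the frame `σ`. Multiplying by `Sᴴ` and `S` on the two sides, with `H = Sᴴ S`, gives `H = H G H`
  -- and hence `G = H⁻¹`.
  have hP : columnProj S.1 = S.1 * G * S.1ᴴ := by
    ext j k
    rw [← proj_mk, ← metric_coordFun, h, h, metric_sum_smul]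
    simp only [Matrix.mul_apply, Matrix.conjTranspose_apply, Finset.sum_mul, hG, Matrix.of_apply]
    rw [Finset.sum_comm]
    refine Finset.sum_congr rfl fun b _ => Finset.sum_congr rfl fun a _ => ?_
    rw [mul_right_comm]
    rfl
  have h1 : S.1ᴴ * S.1 = (S.1ᴴ * S.1) * G * (S.1ᴴ * S.1) := by
    have h2 := congrArg (S.1ᴴ * ·) (columnProj_mul_self S)
    simp only [hP, Matrix.mul_assoc] at h2
    simp only [Matrix.mul_assoc]
    exact h2.symm
  have hu := S.isUnit_det_gram
  refine (Matrix.inv_eq_left_inv ?_).symm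
  generalize S.1ᴴ * S.1 = H at *
  have h2 := congrArg (H⁻¹ * ·) h1
  simp only [Matrix.mul_assoc] at h2
  rw [Matrix.nonsing_inv_mul _ hu, ← Matrix.mul_assoc, Matrix.nonsing_inv_mul _ hu,
    Matrix.one_mul] at h2
  exact h2.symm

/-- If the defect between two subspaces `W` and `A W` vanishes and `A = U R` is a polar
decomposition, then `A W = U W`. -/
theorem unitaryMap_mk_of_commute (A : GL (Fin N) ℂ) (U : Matrix.unitaryGroup (Fin N) ℂ)
    (R : Matrix (Fin N) (Fin N) ℂ) (hR : IsUnit R) (hA : A.1 = U.1 * R) (S : FullRank r N)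
    (hc : Commute R (columnProj S.1)) : mk (S.mulLeft A) = unitaryMap U (mk S) := by
  -- Since `P S = S` and `R` commutes with `P = S (Sᴴ S)⁻¹ Sᴴ`, one has `R S = P R S = S g`: the
  -- columns of `R S` stay in the column space of `S`. A rank count then makes `g` invertible.
  have hRS : R * S.1 = S.1 * ((S.1ᴴ * S.1)⁻¹ * S.1ᴴ * (R * S.1)) := by
    conv_lhs => rw [← columnProj_mul_self S, ← Matrix.mul_assoc, hc.eq, columnProj]
    simp only [Matrix.mul_assoc]
  set g := (S.1ᴴ * S.1)⁻¹ * S.1ᴴ * (R * S.1) with hg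
  have hrank : g.rank = r := by
    apply le_antisymm
    · simpa using g.rank_le_card_width
    · have h1 : (S.1 * g).rank = r := by
        rw [← hRS, Matrix.rank_mul_eq_right_of_isUnit_det _ _
          ((Matrix.isUnit_iff_isUnit_det _).1 hR), S.2]
      exact h1.symm.le.trans (Matrix.rank_mul_le_right _ _)
  have hdet : g.det ≠ 0 := by
    have h4 := Matrix.mulVec_injective_iff_isUnit.1
      (FullRank.mulVec_injective (⟨g, hrank⟩ : FullRank r r))
    exact isUnit_iff_ne_zero.1 ((Matrix.isUnit_iff_isUnit_det _).1 h4)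
  refine (mk_eq_of (A := ⟨U.1 * S.1, _⟩) (B := S.mulLeft A) hdet ?_).symm
  change A.1 * S.1 = U.1 * S.1 * g
  rw [hA, Matrix.mul_assoc, Matrix.mul_assoc, ← hRS]

/-- A vanishing defect means `A P = P' A`. Its adjoint is `P Aᴴ = Aᴴ P'`, and together `Aᴴ A P = Aᴴ
P' A = P Aᴴ A`. -/
theorem commute_of_defect_eq_zero (A : GL (Fin N) ℂ) (S : FullRank r N)
    (h : defect A (columnProj S.1) (columnProj (S.mulLeft A).1) = 0) :
    Commute (A.1ᴴ * A.1) (columnProj S.1) := by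
  have hP := isHermitian_columnProj S.1
  have hP' := isHermitian_columnProj (S.mulLeft A).1
  rw [defect_eq, sub_eq_zero] at h
  generalize columnProj S.1 = P at *
  generalize columnProj (S.mulLeft A).1 = P' at *
  have h1 : A.1 * (A⁻¹).1 = 1 := by rw [← Units.val_mul]; simp
  have h2 : (A⁻¹).1 * A.1 = 1 := by rw [← Units.val_mul]; simp
  have h3 : A.1 * P = P' * A.1 := by
    have := congrArg (fun X => A.1 * X * A.1) h
    simp only [Matrix.mul_assoc] at this
    rw [h2, Matrix.mul_one, ← Matrix.mul_assoc, h1, Matrix.one_mul] at this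
    exact this
  have h4 : P * A.1ᴴ = A.1ᴴ * P' := by
    have := congrArg Matrix.conjTranspose h3
    simpa only [Matrix.conjTranspose_mul, hP, hP'] using this
  change A.1ᴴ * A.1 * P = P * (A.1ᴴ * A.1)
  rw [Matrix.mul_assoc, h3, ← Matrix.mul_assoc, ← h4, Matrix.mul_assoc]

end Gr

end Balanced

end

noncomputable section

namespace Balanced

open Matrix Topology Set

/-! ### Positivity of the top power of a positive `(1,1)`-form -/

section Pfaffian

variable {n : ℕ}

/-- The standard symplectic form of `ℂⁿ`. -/
def stdSymplectic (n : ℕ) (v w : Fin n → ℂ) : ℝ := (star v ⬝ᵥ w).im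

theorem stdSymplectic_add_left (u v w : Fin n → ℂ) :
    stdSymplectic n (u + v) w = stdSymplectic n u w + stdSymplectic n v w := by
  simp [stdSymplectic, add_dotProduct]

theorem stdSymplectic_add_right (u v w : Fin n → ℂ) :
    stdSymplectic n u (v + w) = stdSymplectic n u v + stdSymplectic n u w := by
  simp [stdSymplectic, dotProduct_add]

theorem stdSymplectic_smul_left (c : ℝ) (v w : Fin n → ℂ) :
    stdSymplectic n (c • v) w = c * stdSymplectic n v w := by
  have : star (c • v) = (c : ℂ) • star v := by
    ext i; simp
  rw [stdSymplectic, this, smul_dotProduct, stdSymplectic, smul_eq_mul, Complex.im_ofReal_mul]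

theorem stdSymplectic_smul_right (c : ℝ) (v w : Fin n → ℂ) :
    stdSymplectic n v (c • w) = c * stdSymplectic n v w := by
  rw [stdSymplectic, dotProduct_smul, stdSymplectic, Complex.smul_im, smul_eq_mul]

theorem stdSymplectic_realBasis (p q : Fin n × Fin 2) :
    stdSymplectic n (realBasis n p) (realBasis n q)
      = if p.1 = q.1 then (q.2 : ℝ) - (p.2 : ℝ) else 0 := by
  obtain ⟨i, a⟩ := p
  obtain ⟨j, b⟩ := q
  have : stdSymplectic n (realBasis n (i, a)) (realBasis n (j, b))
      = if i = j then ((starRingEnd ℂ) (if a = 0 then 1 else Complex.I)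
        * (if b = 0 then 1 else Complex.I)).im else 0 := by
    simp only [stdSymplectic, realBasis, dotProduct_single, Pi.star_apply]
    split_ifs with h <;> first | subst h | skip
    all_goals simp [*]
  rw [this]
  fin_cases a <;> fin_cases b <;> simp

/-- `(v₁, …, v₂ₙ) ↦ ∏ᵢ ω₀ (v₂ᵢ₋₁, v₂ᵢ)`. -/
def pairProduct (n : ℕ) : MultilinearMap ℝ (fun _ : Fin n × Fin 2 => Fin n → ℂ) ℝ :=
  MultilinearMap.mk' (fun v => ∏ i, stdSymplectic n (v (i, 0)) (v (i, 1)))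
    (by
      rintro v ⟨i, a⟩ x y
      -- The vector in slot `(i, a)` enters only the `i`-th factor, so that factor is split off and
      -- the others are unchanged by the update.
      simp only [← Finset.mul_prod_erase Finset.univ _ (Finset.mem_univ i)]
      have hne : ∀ z, ∀ j ∈ Finset.univ.erase i, ∀ b, Function.update v (i, a) z (j, b) = v (j, b) :=
        fun z j hj b => Function.update_of_ne (by simp [Finset.ne_of_mem_erase hj]) _ _
      have hp : ∀ z, ∏ j ∈ Finset.univ.erase i, stdSymplectic n (Function.update v (i, a) z (j, 0))
          (Function.update v (i, a) z (j, 1)) = ∏ j ∈ Finset.univ.erase i,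
          stdSymplectic n (v (j, 0)) (v (j, 1)) := fun z =>
        Finset.prod_congr rfl fun j hj => by rw [hne z j hj, hne z j hj]
      rw [hp, hp, hp, ← add_mul]
      congr 1
      fin_cases a <;> simp [Function.update, stdSymplectic_add_left, stdSymplectic_add_right])
    (by
      rintro v ⟨i, a⟩ c x
      simp only [← Finset.mul_prod_erase Finset.univ _ (Finset.mem_univ i)]
      have hne : ∀ z, ∀ j ∈ Finset.univ.erase i, ∀ b, Function.update v (i, a) z (j, b) = v (j, b) :=
        fun z j hj b => Function.update_of_ne (by simp [Finset.ne_of_mem_erase hj]) _ _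
      have hp : ∀ z, ∏ j ∈ Finset.univ.erase i, stdSymplectic n (Function.update v (i, a) z (j, 0))
          (Function.update v (i, a) z (j, 1)) = ∏ j ∈ Finset.univ.erase i,
          stdSymplectic n (v (j, 0)) (v (j, 1)) := fun z =>
        Finset.prod_congr rfl fun j hj => by rw [hne z j hj, hne z j hj]
      rw [hp, hp, smul_eq_mul, ← mul_assoc]
      congr 1
      fin_cases a <;> simp [Function.update, stdSymplectic_smul_left, stdSymplectic_smul_right])

theorem alternatization_pairProduct_apply (v : Fin n × Fin 2 → Fin n → ℂ) :
    MultilinearMap.alternatization (pairProduct n) v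
      = ∑ σ : Equiv.Perm (Fin n × Fin 2), ((Equiv.Perm.sign σ : ℤ) : ℝ) *
        ∏ i, stdSymplectic n (v (σ (i, 0))) (v (σ (i, 1))) := by
  rw [MultilinearMap.alternatization_apply]
  refine Finset.sum_congr rfl fun σ _ => ?_
  rw [Units.smul_def, zsmul_eq_mul]
  rfl

/-- The product vanishes unless `σ` maps each pair `{(i, 0), (i, 1)}` onto a pair. In that case `σ`
is a permutation `ρ` of the pairs after permutations `τ i` inside them. The contribution of `ρ` to
the sign is a square, and each factor of the product is the sign of `τ i`, so the product equals
`sign σ`. -/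
theorem sign_mul_prod_stdSymplectic_nonneg (σ : Equiv.Perm (Fin n × Fin 2)) :
    0 ≤ ((Equiv.Perm.sign σ : ℤ) : ℝ) *
      ∏ i, stdSymplectic n (realBasis n (σ (i, 0))) (realBasis n (σ (i, 1))) := by
  by_cases h : ∀ i, (σ (i, 0)).1 = (σ (i, 1)).1
  · have h' : ∀ i a, (σ (i, a)).1 = (σ (i, 0)).1 := by
      intro i a
      fin_cases a
      · rfl
      · exact (h i).symm
    have hsurj : Function.Surjective fun i => (σ (i, 0)).1 := by
      intro k
      obtain ⟨⟨i, a⟩, hi⟩ := σ.surjective (k, 0)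
      exact ⟨i, (h' i a).symm.trans (by rw [hi])⟩
    let ρ : Equiv.Perm (Fin n) := Equiv.ofBijective _ (Finite.surjective_iff_bijective.1 hsurj)
    have hinj : ∀ i, Function.Injective fun a => (σ (i, a)).2 := by
      intro i a b hab
      have : σ (i, a) = σ (i, b) := Prod.ext ((h' i a).trans (h' i b).symm) hab
      exact (Prod.ext_iff.1 (σ.injective this)).2
    let τ : Fin n → Equiv.Perm (Fin 2) := fun i =>
      Equiv.ofBijective _ (Finite.injective_iff_bijective.1 (hinj i))
    have hσ : σ = Equiv.prodCongrLeft (fun _ : Fin 2 => ρ) * Equiv.prodCongrRight τ := by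
      ext1 ⟨i, a⟩
      rw [Equiv.Perm.mul_apply, Equiv.prodCongrRight_apply, Equiv.prodCongrLeft_apply]
      exact Prod.ext (h' i a) rfl
    have hsign : Equiv.Perm.sign σ = ∏ i, Equiv.Perm.sign (τ i) := by
      rw [hσ, Equiv.Perm.sign_mul, Equiv.Perm.sign_prodCongrLeft, Equiv.Perm.sign_prodCongrRight,
        Fin.prod_univ_two, Int.units_mul_self, one_mul]
    have hfac : ∀ ρ : Equiv.Perm (Fin 2), (((ρ 1 : ℕ) : ℤ) - ((ρ 0 : ℕ) : ℤ))
        = (Equiv.Perm.sign ρ : ℤ) := by decide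
    have hprod : ∏ i, stdSymplectic n (realBasis n (σ (i, 0))) (realBasis n (σ (i, 1)))
        = ((Equiv.Perm.sign σ : ℤ) : ℝ) := by
      rw [hsign, Units.coe_prod, Int.cast_prod]
      refine Finset.prod_congr rfl fun i _ => ?_
      rw [stdSymplectic_realBasis, if_pos (h i), ← hfac]
      push_cast
      rfl
    rw [hprod]
    exact mul_self_nonneg _
  · push Not at h
    obtain ⟨i, hi⟩ := h
    rw [Finset.prod_eq_zero (Finset.mem_univ i), mul_zero]
    rw [stdSymplectic_realBasis, if_neg hi]

theorem alternatization_pairProduct_realBasis_pos :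
    0 < MultilinearMap.alternatization (pairProduct n) (realBasis n) := by
  rw [alternatization_pairProduct_apply]
  refine Finset.sum_pos' (fun σ _ => sign_mul_prod_stdSymplectic_nonneg σ)
    ⟨1, Finset.mem_univ _, ?_⟩
  simp [stdSymplectic_realBasis]

theorem exists_basis_eq_realBasis (n : ℕ) :
    ∃ b : Module.Basis (Fin n × Fin 2) ℝ (Fin n → ℂ), ⇑b = realBasis n := by
  refine ⟨Complex.basisOneI.smulTower' (Pi.basisFun ℂ (Fin n)), ?_⟩
  funext ⟨i, a⟩
  rw [Module.Basis.smulTower'_apply]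
  ext j
  fin_cases a <;> simp [realBasis, Pi.single_apply]

open scoped ComplexOrder MatrixOrder in
/-- A positive real `(1,1)`-form on `ℂⁿ` is the pullback of the standard symplectic form under a
complex linear isomorphism. -/
theorem exists_stdSymplectic_pullback (η : (Fin n → ℂ) → (Fin n → ℂ) → ℝ)
    (add_left : ∀ u v w, η (u + v) w = η u w + η v w)
    (smul_left : ∀ (c : ℝ) v w, η ((c : ℂ) • v) w = c * η v w)
    (antisymm : ∀ v w, η v w = -η w v)
    (map_I : ∀ v w, η (Complex.I • v) (Complex.I • w) = η v w)
    (pos : ∀ v, v ≠ 0 → 0 < η v (Complex.I • v)) :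
    ∃ B : Matrix (Fin n) (Fin n) ℂ, B.det ≠ 0 ∧
      ∀ v w, η v w = stdSymplectic n (B *ᵥ v) (B *ᵥ w) := by
  have add_right : ∀ u v w, η u (v + w) = η u v + η u w := by
    intro u v w
    rw [antisymm, add_left, antisymm v, antisymm w]; ring
  have smul_right : ∀ (c : ℝ) v w, η v ((c : ℂ) • w) = c * η v w := by
    intro c v w
    rw [antisymm, smul_left, antisymm w]; ring
  have neg_right : ∀ v w, η v (-w) = -η v w := by
    intro v w
    simpa using smul_right (-1) v w
  have map_I' : ∀ v w, η (Complex.I • v) w = -η v (Complex.I • w) := by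
    intro v w
    rw [← map_I v (Complex.I • w), smul_smul, Complex.I_mul_I, neg_one_smul, neg_right, neg_neg]
  -- The Hermitian form with imaginary part `η`. It is linear in the second variable, and positive
  -- definite by the positivity of `η`.
  let H : (Fin n → ℂ) → (Fin n → ℂ) → ℂ := fun v w => η v (Complex.I • w) + Complex.I * η v w
  have hH_conj : ∀ v w, (starRingEnd ℂ) (H v w) = H w v := by
    intro v w
    simp only [H, map_add, map_mul, Complex.conj_ofReal, Complex.conj_I]
    rw [antisymm v (Complex.I • w), map_I', antisymm w v]
    push_cast; ring
  have hH_smul : ∀ (c : ℂ) v w, H v (c • w) = c * H v w := by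
    intro c v w
    have h1 : c • w = (c.re : ℂ) • w + (c.im : ℂ) • (Complex.I • w) := by
      rw [smul_smul, ← add_smul, Complex.re_add_im]
    have h2 : Complex.I • c • w = (c.re : ℂ) • Complex.I • w + (-c.im : ℝ) • w := by
      rw [h1, smul_add, smul_comm Complex.I (c.im : ℂ), smul_smul Complex.I Complex.I,
        Complex.I_mul_I, smul_comm Complex.I (c.re : ℂ)]
      simp
    have h3 : η v ((-c.im : ℝ) • w) = -c.im * η v w := smul_right (-c.im) v w
    simp only [H]
    rw [h2, h1, add_right, add_right, smul_right, smul_right, smul_right, h3]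
    conv_rhs => rw [← Complex.re_add_im c]
    push_cast
    linear_combination (-(c.im : ℂ) * η v w) * Complex.I_mul_I
  have hH_add : ∀ u v w, H u (v + w) = H u v + H u w := by
    intro u v w
    simp only [H, smul_add, add_right]
    push_cast; ring
  let Hr : (Fin n → ℂ) → (Fin n → ℂ) →ₗ[ℂ] ℂ := fun v =>
    { toFun := H v
      map_add' := hH_add v
      map_smul' := fun c w => hH_smul c v w }
  have hr : ∀ v w, H v w = ∑ k, H v (Pi.single k 1) * w k := by
    intro v w
    change Hr v w = ∑ k, Hr v _ * _
    conv_lhs => rw [pi_eq_sum_univ' w]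
    simp [map_sum, mul_comm]
  let G : Matrix (Fin n) (Fin n) ℂ := Matrix.of fun j k => H (Pi.single j 1) (Pi.single k 1)
  have hG : ∀ v w, H v w = star v ⬝ᵥ (G *ᵥ w) := by
    intro v w
    have h1 : ∀ k, H v (Pi.single k 1) = ∑ j, star (v j) * G j k := by
      intro k
      rw [← hH_conj, hr, map_sum]
      refine Finset.sum_congr rfl fun j _ => ?_
      rw [map_mul, hH_conj, mul_comm]
      rfl
    rw [hr, Matrix.dotProduct_mulVec]
    simp only [h1]
    rfl
  have hGh : G.IsHermitian := by
    ext j k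
    exact hH_conj _ _
  have hGpos : G.PosDef := by
    refine Matrix.PosDef.of_dotProduct_mulVec_pos hGh fun v hv => ?_
    rw [← hG]
    have h0 : η v v = 0 := by linarith [antisymm v v]
    simp only [H, h0]
    simpa using pos v hv
  have h0 : 0 ≤ G := hGpos.posSemidef.nonneg
  have hBB : CFC.sqrt G * CFC.sqrt G = G := CFC.sqrt_mul_sqrt_self _ h0
  have hBs : (CFC.sqrt G)ᴴ = CFC.sqrt G := (CFC.sqrt_nonneg G).isSelfAdjoint
  -- With `B` the Hermitian square root of the Gram matrix, `H v w = (B v)* (B w)`, whose imaginary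
  -- part is the standard form at `B v`, `B w`.
  refine ⟨CFC.sqrt G, ?_, fun v w => ?_⟩
  · intro hdet
    have hu := (Matrix.isUnit_iff_isUnit_det _).1 hGpos.isUnit
    rw [← hBB, Matrix.det_mul, hdet, mul_zero] at hu
    exact not_isUnit_zero hu
  · rw [stdSymplectic, Matrix.star_mulVec, hBs, Matrix.dotProduct_mulVec, Matrix.vecMul_vecMul,
      hBB, ← Matrix.dotProduct_mulVec, ← hG]
    simp [H]

/-- After pulling back from the standard form by `B`, the sum is an alternating form in `2n` real
variables evaluated on the image of a basis. Hence it is its value on the basis times the real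
determinant of `B`, which is `|det B|² > 0`. On the standard basis no term is negative and the
identity permutation contributes `1`. -/
theorem pfaffian_pos (η : (Fin n → ℂ) → (Fin n → ℂ) → ℝ)
    (add_left : ∀ u v w, η (u + v) w = η u w + η v w)
    (smul_left : ∀ (c : ℝ) v w, η ((c : ℂ) • v) w = c * η v w)
    (antisymm : ∀ v w, η v w = -η w v)
    (map_I : ∀ v w, η (Complex.I • v) (Complex.I • w) = η v w)
    (pos : ∀ v, v ≠ 0 → 0 < η v (Complex.I • v)) :
    0 < ∑ σ : Equiv.Perm (Fin n × Fin 2), ((Equiv.Perm.sign σ : ℤ) : ℝ) *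
        ∏ i, η (realBasis n (σ (i, 0))) (realBasis n (σ (i, 1))) := by
  obtain ⟨B, hB, h⟩ := exists_stdSymplectic_pullback η add_left smul_left antisymm map_I pos
  obtain ⟨b, hb⟩ := exists_basis_eq_realBasis n
  simp only [h]
  have h1 := alternatization_pairProduct_apply ((B.toLin'.restrictScalars ℝ) ∘ realBasis n)
  have h2 := alternatization_pairProduct_realBasis_pos (n := n)
  refine lt_of_lt_of_eq ?_ h1
  rw [← hb] at h2 ⊢
  rw [AlternatingMap.eq_smul_basis_det b (MultilinearMap.alternatization (pairProduct n)),
    AlternatingMap.smul_apply, Module.Basis.det_comp, Module.Basis.det_self, mul_one, smul_eq_mul,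
    LinearMap.det_restrictScalars, LinearMap.det_toLin', Algebra.norm_complex_apply]
  exact mul_pos h2 (Complex.normSq_pos.2 hB)

end Pfaffian

end Balanced

end

noncomputable section

namespace Balanced

open Matrix Topology Set MeasureTheory

/-! ### The volume integral as a strictly positive functional -/

section Volume

variable {n : ℕ} {M : Type*} [TopologicalSpace M] [ChartedSpace (Fin n → ℂ) M]

/-- The derivative of the inverse chart is complex linear and injective, so in coordinates `Ω` is
again a positive `(1,1)`-form, and `pfaffian_pos` applies. -/
theorem volDensity_pos [IsManifold 𝓘(ℂ, Fin n → ℂ) ω M] (Ω : KaehlerForm n M) (x₀ : M)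
    {y : Fin n → ℂ} (hy : y ∈ (chartAt (Fin n → ℂ) x₀).target) : 0 < volDensity Ω x₀ y := by
  have : IsManifold 𝓘(ℂ, Fin n → ℂ) 1 M := .of_le (n := ω) le_top
  let D : (Fin n → ℂ) →L[ℂ] TangentSpace 𝓘(ℂ, Fin n → ℂ) ((chartAt (Fin n → ℂ) x₀).symm y) :=
    mfderiv 𝓘(ℂ, Fin n → ℂ) 𝓘(ℂ, Fin n → ℂ) (chartAt (Fin n → ℂ) x₀).symm y
  have hinj : Function.Injective D :=
    (mdifferentiable_chart (I := 𝓘(ℂ, Fin n → ℂ)) x₀).symm.mfderiv_injective hy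
  have h := pfaffian_pos (localForm Ω.toFun x₀ y)
    (fun u v w => by
      change Ω.toFun _ (D (u + v)) (D w) = Ω.toFun _ (D u) (D w) + Ω.toFun _ (D v) (D w)
      rw [map_add, Ω.add_left])
    (fun c v w => by
      change Ω.toFun _ (D ((c : ℂ) • v)) (D w) = c * Ω.toFun _ (D v) (D w)
      rw [map_smul, Ω.smul_left])
    (fun v w => Ω.antisymm _ _ _)
    (fun v w => by
      change Ω.toFun _ (D (Complex.I • v)) (D (Complex.I • w)) = Ω.toFun _ (D v) (D w)
      rw [map_smul, map_smul, Ω.map_I])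
    (fun v hv => by
      change 0 < Ω.toFun _ (D v) (D (Complex.I • v))
      rw [map_smul]
      exact Ω.pos _ _ ((map_ne_zero_iff D hinj).2 hv))
  rw [volDensity]
  positivity

theorem continuousOn_volDensity (Ω : KaehlerForm n M) (x₀ : M) :
    ContinuousOn (volDensity Ω x₀) (chartAt (Fin n → ℂ) x₀).target := by
  unfold volDensity
  refine continuousOn_const.mul (continuousOn_const.mul ?_)
  refine continuousOn_finsetSum _ fun σ _ => continuousOn_const.mul ?_
  exact continuousOn_finsetProd _ fun i _ => (Ω.smooth x₀ _ _).continuousOn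

variable [CompactSpace M] [T2Space M]

theorem tsupport_partition_subset (x₀ : M) :
    tsupport (partition n M x₀) ⊆ (chartAt (Fin n → ℂ) x₀).source :=
  (exists_partition n M).choose_spec x₀

theorem finite_support_partition : {x₀ : M | (Function.support (partition n M x₀)).Nonempty}.Finite :=
  (partition n M).locallyFinite.finite_nonempty_of_compact

/-- The integrand of `volIntegral` in the chart around `x₀`. -/
def volIntegrand (Ω : KaehlerForm n M) (f : M → ℂ) (x₀ : M) (y : Fin n → ℂ) : ℂ :=
  (partition n M x₀ ((chartAt (Fin n → ℂ) x₀).symm y) : ℂ) *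
    f ((chartAt (Fin n → ℂ) x₀).symm y) * (volDensity Ω x₀ y : ℂ)

theorem continuousOn_volIntegrand (Ω : KaehlerForm n M) {f : M → ℂ} (hf : Continuous f) (x₀ : M) :
    ContinuousOn (volIntegrand Ω f x₀) (chartAt (Fin n → ℂ) x₀).target := by
  have hs := (chartAt (Fin n → ℂ) x₀).continuousOn_symm
  refine ContinuousOn.mul (ContinuousOn.mul ?_ (hf.comp_continuousOn hs)) ?_
  · exact (Complex.continuous_ofReal.comp (partition n M x₀).continuous).comp_continuousOn hs
  · exact Complex.continuous_ofReal.comp_continuousOn (continuousOn_volDensity Ω x₀)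

/-- The chart target may be unbounded, but the integrand vanishes off the image of the support of
the partition function, a compact set inside the target on which it is continuous. -/
theorem integrableOn_volIntegrand (Ω : KaehlerForm n M) {f : M → ℂ} (hf : Continuous f) (x₀ : M) :
    IntegrableOn (volIntegrand Ω f x₀) (chartAt (Fin n → ℂ) x₀).target := by
  set φ := chartAt (Fin n → ℂ) x₀
  have hK : IsCompact (φ '' tsupport (partition n M x₀)) :=
    (isClosed_tsupport _).isCompact.image_of_continuousOn
      (φ.continuousOn.mono (tsupport_partition_subset x₀))
  have hKt : φ '' tsupport (partition n M x₀) ⊆ φ.target := by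
    rintro _ ⟨x, hx, rfl⟩
    exact φ.map_source (tsupport_partition_subset x₀ hx)
  refine IntegrableOn.of_forall_sdiff_eq_zero
    (((continuousOn_volIntegrand Ω hf x₀).mono hKt).integrableOn_compact hK)
    φ.open_target.measurableSet ?_
  rintro y ⟨hy, hyK⟩
  have : partition n M x₀ (φ.symm y) = 0 := by
    by_contra h
    exact hyK ⟨φ.symm y, subset_tsupport _ h, φ.right_inv hy⟩
  change (partition n M x₀ (φ.symm y) : ℂ) * _ * _ = 0
  rw [this]; simp

/-- By compactness only finitely many functions of the locally finite partition are nonzero, so the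
`finsum` is an honest finite sum over an index set independent of `f`. -/
theorem volIntegral_eq_sum (Ω : KaehlerForm n M) (f : M → ℂ) :
    volIntegral Ω f = ∑ x₀ ∈ (finite_support_partition (n := n) (M := M)).toFinset,
      ∫ y in (chartAt (Fin n → ℂ) x₀).target, volIntegrand Ω f x₀ y := by
  refine finsum_eq_sum_of_support_subset _ fun x₀ hx₀ => ?_
  rw [Finite.coe_toFinset, mem_ofPred_eq]
  by_contra h
  rw [Set.not_nonempty_iff_eq_empty, Function.support_eq_empty_iff] at h
  refine hx₀ ?_
  simp [h]

/-- `∫_M f ωⁿ / n!`, as a linear functional on the continuous functions. -/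
def volFunctional [IsManifold 𝓘(ℂ, Fin n → ℂ) ω M] (Ω : KaehlerForm n M) : C(M, ℂ) →ₗ[ℂ] ℂ where
  toFun f := volIntegral Ω f
  map_add' f g := by
    simp only [volIntegral_eq_sum, ← Finset.sum_add_distrib]
    refine Finset.sum_congr rfl fun x₀ _ => ?_
    rw [← integral_add (integrableOn_volIntegrand Ω f.continuous x₀)
      (integrableOn_volIntegrand Ω g.continuous x₀)]
    congr 1
    funext y
    simp only [volIntegrand, ContinuousMap.add_apply]
    ring
  map_smul' c f := by
    simp only [volIntegral_eq_sum, RingHom.id_apply, smul_eq_mul, Finset.mul_sum]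
    refine Finset.sum_congr rfl fun x₀ _ => ?_
    rw [← integral_const_mul]
    congr 1
    funext y
    simp only [volIntegrand, ContinuousMap.smul_apply, smul_eq_mul]
    ring

/-- Every chart contributes a nonnegative integral, so each is zero, and a continuous nonnegative
integrand on an open set then vanishes identically. At `x` some partition function is positive, and
so is the density, which leaves `f x = 0`. -/
theorem eq_zero_of_volIntegral_eq_zero [IsManifold 𝓘(ℂ, Fin n → ℂ) ω M] (Ω : KaehlerForm n M)
    {f : M → ℝ} (hf : Continuous f) (hnn : ∀ x, 0 ≤ f x)
    (h : volIntegral Ω (fun x => (f x : ℂ)) = 0) (x : M) : f x = 0 := by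
  let F : M → (Fin n → ℂ) → ℝ := fun x₀ y =>
    partition n M x₀ ((chartAt (Fin n → ℂ) x₀).symm y) *
      f ((chartAt (Fin n → ℂ) x₀).symm y) * volDensity Ω x₀ y
  have hF : ∀ x₀ y, volIntegrand Ω (fun x => (f x : ℂ)) x₀ y = (F x₀ y : ℂ) := by
    intro x₀ y
    simp [volIntegrand, F]
  have hfc : Continuous fun x => (f x : ℂ) := Complex.continuous_ofReal.comp hf
  have hF0 : ∀ x₀, ∀ y ∈ (chartAt (Fin n → ℂ) x₀).target, 0 ≤ F x₀ y := fun x₀ y hy =>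
    mul_nonneg (mul_nonneg ((partition n M).nonneg _ _) (hnn _)) (volDensity_pos Ω x₀ hy).le
  have hFc : ∀ x₀, ContinuousOn (F x₀) (chartAt (Fin n → ℂ) x₀).target := by
    intro x₀
    have := Complex.continuous_re.comp_continuousOn (continuousOn_volIntegrand Ω hfc x₀)
    refine this.congr fun y _ => ?_
    simp [hF]
  have hFi : ∀ x₀, IntegrableOn (F x₀) (chartAt (Fin n → ℂ) x₀).target := by
    intro x₀
    have := (integrableOn_volIntegrand Ω hfc x₀).re
    refine this.congr (Filter.Eventually.of_forall fun y => ?_)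
    simp [hF]
  have hint : ∀ x₀, 0 ≤ ∫ y in (chartAt (Fin n → ℂ) x₀).target, F x₀ y := fun x₀ =>
    setIntegral_nonneg (chartAt (Fin n → ℂ) x₀).open_target.measurableSet (hF0 x₀)
  rw [volIntegral_eq_sum] at h
  simp only [hF, integral_complex_ofReal] at h
  rw [← Complex.ofReal_sum, Complex.ofReal_eq_zero,
    Finset.sum_eq_zero_iff_of_nonneg fun x₀ _ => hint x₀] at h
  obtain ⟨x₀, hx₀⟩ := (partition n M).exists_pos (mem_univ x)
  have hxs : x ∈ (chartAt (Fin n → ℂ) x₀).source :=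
    tsupport_partition_subset x₀ (subset_tsupport _ hx₀.ne')
  have h1 := h x₀ (by rw [Finite.mem_toFinset]; exact ⟨x, hx₀.ne'⟩)
  rw [setIntegral_eq_zero_iff_of_nonneg_ae
    (ae_restrict_of_forall_mem (chartAt (Fin n → ℂ) x₀).open_target.measurableSet (hF0 x₀))
    (hFi x₀)] at h1
  have h2 := Measure.eqOn_open_of_ae_eq h1 (chartAt (Fin n → ℂ) x₀).open_target (hFc x₀)
    continuousOn_const ((chartAt (Fin n → ℂ) x₀).map_source hxs)
  simp only [F, (chartAt (Fin n → ℂ) x₀).left_inv hxs, Pi.zero_apply] at h2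
  have h3 := volDensity_pos Ω x₀ ((chartAt (Fin n → ℂ) x₀).map_source hxs)
  rcases mul_eq_zero.1 h2 with h2 | h2
  · exact (mul_eq_zero.1 h2).resolve_left hx₀.ne'
  · exact absurd h2 h3.ne'

end Volume

end Balanced

end

noncomputable section

namespace Balanced

open Matrix Topology Set Filter

/-! ### The operator `∂∂̄` under holomorphic maps and on pluriharmonic functions -/

section Ddbar

variable {V W : Type*} [NormedAddCommGroup V] [NormedSpace ℂ V] [NormedAddCommGroup W]
  [NormedSpace ℂ W]

theorem dirDeriv_eq_fderiv {X : Type*} [NormedAddCommGroup X] [NormedSpace ℝ X] {u : V → X} {y : V}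
    (hu : DifferentiableAt ℝ u y) (v : V) : dirDeriv u v y = fderiv ℝ u y v := by
  have h1 : HasDerivAt (fun t : ℝ => y + (t : ℂ) • v) v 0 := by
    have := ((hasDerivAt_id (0 : ℝ)).smul_const v).const_add y
    simpa using this
  have h2 : HasFDerivAt u (fderiv ℝ u y) (y + ((0 : ℝ) : ℂ) • v) := by
    simpa using hu.hasFDerivAt
  exact (h2.comp_hasDerivAt (0 : ℝ) h1).deriv

theorem dirDeriv_congr {X : Type*} [NormedAddCommGroup X] [NormedSpace ℝ X] {u u' : V → X} {y : V}
    (h : u =ᶠ[𝓝 y] u') (v : V) : dirDeriv u v y = dirDeriv u' v y := by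
  refine Filter.EventuallyEq.deriv_eq ?_
  have hc : Tendsto (fun t : ℝ => y + (t : ℂ) • v) (𝓝 0) (𝓝 y) := by
    have : Continuous fun t : ℝ => y + (t : ℂ) • v := by fun_prop
    simpa using this.tendsto 0
  exact hc.eventually h

theorem eventually_dirDeriv_congr {X : Type*} [NormedAddCommGroup X] [NormedSpace ℝ X]
    {u u' : V → X} {y : V} (h : u =ᶠ[𝓝 y] u') (v : V) : dirDeriv u v =ᶠ[𝓝 y] dirDeriv u' v :=
  h.eventuallyEq_nhds.mono fun _ hz => dirDeriv_congr hz v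

theorem ddbar_congr {u u' : V → ℂ} {y : V} (h : u =ᶠ[𝓝 y] u') (v w : V) :
    ddbar u y v w = ddbar u' y v w := by
  have h1 : ∀ a, dzbar u a =ᶠ[𝓝 y] dzbar u' a := by
    intro a
    filter_upwards [eventually_dirDeriv_congr h a, eventually_dirDeriv_congr h (Complex.I • a)]
      with z hz hz'
    rw [dzbar, dzbar, hz, hz']
  simp only [ddbar, dz, dirDeriv_congr (h1 _)]

theorem dz_dzbar_eq {u : V → ℂ} {y : V} (hu : ContDiffAt ℝ 2 u y) (v w : V) :
    dz (dzbar u w) v y = (1 / 4) * (fderiv ℝ (fderiv ℝ u) y v w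
      + Complex.I * fderiv ℝ (fderiv ℝ u) y v (Complex.I • w)
      - Complex.I * (fderiv ℝ (fderiv ℝ u) y (Complex.I • v) w
        + Complex.I * fderiv ℝ (fderiv ℝ u) y (Complex.I • v) (Complex.I • w))) := by
  have hd : ∀ᶠ z in 𝓝 y, DifferentiableAt ℝ u z :=
    (hu.eventually (by simp)).mono fun z hz => hz.differentiableAt (by simp)
  have h1 : dzbar u w =ᶠ[𝓝 y] fun z =>
      (1 / 2) * (fderiv ℝ u z w + Complex.I * fderiv ℝ u z (Complex.I • w)) := by
    filter_upwards [hd] with z hz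
    rw [dzbar, dirDeriv_eq_fderiv hz, dirDeriv_eq_fderiv hz]
  have h2 : DifferentiableAt ℝ (fderiv ℝ u) y :=
    (hu.fderiv_right (m := 1) (by norm_num)).differentiableAt (by simp)
  have h3 : ∀ a, HasFDerivAt (fun z => fderiv ℝ u z a) ((fderiv ℝ (fderiv ℝ u) y).flip a) y :=
    fun a => by simpa using h2.hasFDerivAt.clm_apply (hasFDerivAt_const a y)
  have h4 : HasFDerivAt (fun z => (1 / 2 : ℂ) *
      (fderiv ℝ u z w + Complex.I * fderiv ℝ u z (Complex.I • w))) _ y := ((h3 w).add ((h3 (Complex.I • w)).const_mul Complex.I)).const_mul (1 / 2 : ℂ)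
  have h5 : ∀ a, dirDeriv (dzbar u w) a y = (1 / 2) * (fderiv ℝ (fderiv ℝ u) y a w
      + Complex.I * fderiv ℝ (fderiv ℝ u) y a (Complex.I • w)) := by
    intro a
    rw [dirDeriv_congr h1, dirDeriv_eq_fderiv h4.differentiableAt]
    refine (congrArg (fun L => L a) h4.fderiv).trans ?_
    simp only [_root_.smul_apply, _root_.add_apply, ContinuousLinearMap.flip_apply,
      smul_eq_mul]
  rw [dz, h5, h5]
  ring

/-- The complex Hessian in terms of the real second derivative. -/
theorem ddbar_eq {u : V → ℂ} {y : V} (hu : ContDiffAt ℝ 2 u y) (v w : V) :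
    ddbar u y v w = (Complex.I / 2) * (fderiv ℝ (fderiv ℝ u) y v (Complex.I • w)
      - fderiv ℝ (fderiv ℝ u) y (Complex.I • v) w) := by
  -- By symmetry of the second derivative, the terms in `(v, w)` and `(I v, I w)` cancel in the
  -- antisymmetrization and the mixed terms double.
  have hs : ∀ a b, fderiv ℝ (fderiv ℝ u) y a b = fderiv ℝ (fderiv ℝ u) y b a := fun a b =>
    hu.isSymmSndFDerivAt (by simp) a b
  rw [ddbar, dz_dzbar_eq hu, dz_dzbar_eq hu, hs w v, hs w (Complex.I • v), hs (Complex.I • w) v,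
    hs (Complex.I • w) (Complex.I • v)]
  ring

/-- The second derivative of `u ∘ F` has an extra term `Du (D²F (a, b))`. As `F` is holomorphic,
`D²F` is complex bilinear, so `D²F (v, I w) = D²F (I v, w)` and the extra term drops out of the
formula of `ddbar_eq`. -/
theorem ddbar_comp {u : W → ℂ} {F : V → W} {y : V} (hu : ContDiffAt ℝ 2 u (F y))
    (hF : ContDiffAt ℂ 2 F y) (v w : V) :
    ddbar (u ∘ F) y v w = ddbar u (F y) (fderiv ℂ F y v) (fderiv ℂ F y w) := by
  have hFr : ContDiffAt ℝ 2 F y := hF.restrict_scalars ℝ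
  have hdF : ∀ᶠ z in 𝓝 y, DifferentiableAt ℂ F z :=
    (hF.eventually (by simp)).mono fun z hz => hz.differentiableAt (by simp)
  have hdu : ∀ᶠ z in 𝓝 y, DifferentiableAt ℝ u (F z) :=
    hF.continuousAt.eventually
      ((hu.eventually (by simp)).mono fun z hz => hz.differentiableAt (by simp))
  have hFI : ∀ᶠ z in 𝓝 y, ∀ a, fderiv ℝ F z a = fderiv ℂ F z a := by
    filter_upwards [hdF] with z hz a
    rw [(hz.hasFDerivAt.restrictScalars ℝ).fderiv]
    rfl
  have h1 : fderiv ℝ (u ∘ F) =ᶠ[𝓝 y] fun z => (fderiv ℝ u (F z)).comp (fderiv ℝ F z) := by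
    filter_upwards [hdF, hdu] with z hz hz'
    exact fderiv_comp z hz' (hz.restrictScalars ℝ)
  have h2u : DifferentiableAt ℝ (fderiv ℝ u) (F y) :=
    (hu.fderiv_right (m := 1) (by norm_num)).differentiableAt (by simp)
  have h2F : DifferentiableAt ℝ (fderiv ℝ F) y :=
    (hFr.fderiv_right (m := 1) (by norm_num)).differentiableAt (by simp)
  have hFd : HasFDerivAt F (fderiv ℝ F y) y := (hFr.differentiableAt (by simp)).hasFDerivAt
  have hD : ∀ a b, fderiv ℝ (fderiv ℝ (u ∘ F)) y a b
      = fderiv ℝ (fderiv ℝ u) (F y) (fderiv ℂ F y a) (fderiv ℂ F y b)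
        + fderiv ℝ u (F y) (fderiv ℝ (fderiv ℝ F) y a b) := by
    intro a b
    rw [h1.fderiv_eq]
    have h3 := (h2u.hasFDerivAt.comp y hFd).clm_comp h2F.hasFDerivAt
    refine (congrArg (fun L => L a b) h3.fderiv).trans ?_
    simp only [_root_.add_apply, ContinuousLinearMap.comp_apply,
      ContinuousLinearMap.compL_apply, ContinuousLinearMap.flip_apply, Function.comp_apply,
      hFI.self_of_nhds]
    rw [add_comm]
  have hsF : ∀ a b, fderiv ℝ (fderiv ℝ F) y a b = fderiv ℝ (fderiv ℝ F) y b a := fun a b =>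
    hFr.isSymmSndFDerivAt (by simp) a b
  have hI : ∀ a b, fderiv ℝ (fderiv ℝ F) y a (Complex.I • b)
      = Complex.I • fderiv ℝ (fderiv ℝ F) y a b := by
    intro a b
    have h3 : ∀ c, HasFDerivAt (fun z => fderiv ℝ F z c) ((fderiv ℝ (fderiv ℝ F) y).flip c) y :=
      fun c => by simpa using h2F.hasFDerivAt.clm_apply (hasFDerivAt_const c y)
    have h4 : (fun z => fderiv ℝ F z (Complex.I • b)) =ᶠ[𝓝 y] fun z => Complex.I • fderiv ℝ F z b := by
      filter_upwards [hFI] with z hz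
      rw [hz, hz, map_smul]
    have h5 := ((h3 b).const_smul Complex.I).congr_of_eventuallyEq h4
    exact congrArg (fun L => L a) ((h3 (Complex.I • b)).unique h5)
  have huF : ContDiffAt ℝ 2 (u ∘ F) y := hu.comp y hFr
  rw [ddbar_eq huF, ddbar_eq hu, hD, hD, hI, hsF (Complex.I • v), hI, hsF w v,
    (fderiv ℂ F y).map_smul, (fderiv ℂ F y).map_smul]
  ring

theorem ddbar_add {u u' : V → ℂ} {y : V} (hu : ContDiffAt ℝ 2 u y) (hu' : ContDiffAt ℝ 2 u' y)
    (v w : V) : ddbar (fun z => u z + u' z) y v w = ddbar u y v w + ddbar u' y v w := by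
  have hd : ∀ {u : V → ℂ}, ContDiffAt ℝ 2 u y → ∀ᶠ z in 𝓝 y, DifferentiableAt ℝ u z := fun hu =>
    (hu.eventually (by simp)).mono fun z hz => hz.differentiableAt (by simp)
  have h2 : ∀ {u : V → ℂ}, ContDiffAt ℝ 2 u y → DifferentiableAt ℝ (fderiv ℝ u) y := fun hu =>
    (hu.fderiv_right (m := 1) (by norm_num)).differentiableAt (by simp)
  have h1 : fderiv ℝ (fun z => u z + u' z) =ᶠ[𝓝 y] fun z => fderiv ℝ u z + fderiv ℝ u' z := by
    filter_upwards [hd hu, hd hu'] with z hz hz'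
    exact fderiv_fun_add hz hz'
  rw [ddbar_eq (hu.add hu'), ddbar_eq hu, ddbar_eq hu', h1.fderiv_eq,
    fderiv_fun_add (h2 hu) (h2 hu')]
  simp only [_root_.add_apply]
  ring

theorem contDiff_ofReal_re {k : ℕ∞ω} : ContDiff ℝ k fun z : ℂ => (z.re : ℂ) :=
  (Complex.ofRealCLM.comp Complex.reCLM).contDiff

theorem ddbar_re (z v w : ℂ) : ddbar (fun z : ℂ => (z.re : ℂ)) z v w = 0 := by
  have h : fderiv ℝ (fun z : ℂ => (z.re : ℂ)) = fun _ => Complex.ofRealCLM.comp Complex.reCLM := by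
    funext z
    exact (Complex.ofRealCLM.comp Complex.reCLM).fderiv
  rw [ddbar_eq contDiff_ofReal_re.contDiffAt, h]
  simp

/-- Adding a pluriharmonic function and composing with a holomorphic map. -/
theorem ddbar_comp_add_re {u₁ : V → ℂ} {u : W → ℂ} {F : V → W} {G : V → ℂ} {y : V}
    (hu : ContDiffAt ℝ 2 u (F y)) (hF : ContDiffAt ℂ 2 F y) (hG : ContDiffAt ℂ 2 G y)
    (h : u₁ =ᶠ[𝓝 y] fun z => u (F z) + ((G z).re : ℂ)) (v w : V) :
    ddbar u₁ y v w = ddbar u (F y) (fderiv ℂ F y v) (fderiv ℂ F y w) := by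
  have h1 : ContDiffAt ℝ 2 (u ∘ F) y := hu.comp y (hF.restrict_scalars ℝ)
  have h2 : ContDiffAt ℝ 2 ((fun z : ℂ => (z.re : ℂ)) ∘ G) y :=
    contDiff_ofReal_re.contDiffAt.comp y (hG.restrict_scalars ℝ)
  rw [ddbar_congr h, ← ddbar_comp hu hF]
  refine (ddbar_add h1 h2 v w).trans ?_
  rw [ddbar_comp contDiff_ofReal_re.contDiffAt hG, ddbar_re, add_zero]

/-- The logarithm of the modulus of a nonvanishing holomorphic function is locally the real part of
a holomorphic function. -/
theorem exists_re_eq_log_norm {g : V → ℂ} {y : V} {k : ℕ∞ω} (hg : ContDiffAt ℂ k g y) (h0 : g y ≠ 0) :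
    ∃ G : V → ℂ, ContDiffAt ℂ k G y ∧ ∀ᶠ z in 𝓝 y, (G z).re = Real.log ‖g z‖ := by
  -- Dividing by `g y` moves the value at `y` to `1`, away from the branch cut of `log`; the
  -- constant `log ‖g y‖` is added back afterwards.
  have h1 : ContDiffAt ℂ k (fun z => g z / g y) y := hg.div_const _
  have h2 : g y / g y ∈ Complex.slitPlane := by
    rw [div_self h0]; exact Complex.one_mem_slitPlane
  refine ⟨fun z => Complex.log (g z / g y) + Real.log ‖g y‖, ((Complex.contDiffAt_log h2).comp y h1).add contDiffAt_const, ?_⟩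
  have h3 : ∀ᶠ z in 𝓝 y, g z ≠ 0 := hg.continuousAt.eventually_ne h0
  filter_upwards [h3] with z hz
  rw [Complex.add_re, Complex.log_re, Complex.ofReal_re, norm_div, Real.log_div
    (norm_ne_zero_iff.2 hz) (norm_ne_zero_iff.2 h0)]
  ring

end Ddbar

end Balanced

end

noncomputable section

namespace Balanced

open Matrix Topology Set Filter

/-! ### Linear coordinates on the fibres of `𝒬` -/

namespace Gr

variable {r N : ℕ}

theorem qOfFrame_apply (A : FullRank r N) (d : Fin r → ℂ) (c : EuclideanSpace ℂ (Fin r)) :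
    (show StrongDual ℂ (taut (mk A)) from qOfFrame A d) ⟨Matrix.toEuclideanLin A.1 c, c, rfl⟩
      = ∑ a, d a * c a := by
  have h : (LinearEquiv.ofInjective _ (injective_of_fullRank A)).symm
      ⟨Matrix.toEuclideanLin A.1 c, c, rfl⟩ = c := by
    rw [LinearEquiv.symm_apply_eq]; rfl
  change (∑ a, d a • (EuclideanSpace.proj a : EuclideanSpace ℂ (Fin r) →L[ℂ] ℂ).toLinearMap)
    ((LinearEquiv.ofInjective _ (injective_of_fullRank A)).symm
      ⟨Matrix.toEuclideanLin A.1 c, c, rfl⟩) = _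
  rw [h]
  simp

theorem Q_ext {p : Gr r N} {φ ψ : Q p}
    (h : ∀ t, (show StrongDual ℂ (taut p) from φ) t = (show StrongDual ℂ (taut p) from ψ) t) :
    φ = ψ :=
  ContinuousLinearMap.ext (f := (show StrongDual ℂ (taut p) from φ)) h

/-- The coordinates of `𝒬` dual to the columns of `A`. -/
def qFrameEquiv (A : FullRank r N) : (Fin r → ℂ) ≃ₗ[ℂ] Q (mk A) :=
  LinearEquiv.ofBijective
    { toFun := qOfFrame A
      map_add' := fun d d' => Q_ext fun ⟨_, c, hc⟩ => by
        subst hc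
        refine (qOfFrame_apply A _ c).trans ?_
        refine Eq.trans ?_ (congrArg₂ (· + ·) (qOfFrame_apply A d c) (qOfFrame_apply A d' c)).symm
        simp only [Pi.add_apply, add_mul, Finset.sum_add_distrib]
      map_smul' := fun k d => Q_ext fun ⟨_, c, hc⟩ => by
        subst hc
        refine (qOfFrame_apply A _ c).trans ?_
        refine Eq.trans ?_ (congrArg (k * ·) (qOfFrame_apply A d c)).symm
        simp only [Pi.smul_apply, smul_eq_mul, Finset.mul_sum, mul_assoc] }
    (by
      refine ⟨fun d d' h => ?_, fun φ => ?_⟩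
      · funext a
        have h1 := qOfFrame_apply A d (EuclideanSpace.single a 1)
        have h2 := qOfFrame_apply A d' (EuclideanSpace.single a 1)
        have h3 : qOfFrame A d = qOfFrame A d' := h
        rw [h3, h2] at h1
        simpa [Pi.single_apply] using h1.symm
      · let L : EuclideanSpace ℂ (Fin r) →ₗ[ℂ] ℂ :=
          (show StrongDual ℂ (taut (mk A)) from φ).toLinearMap ∘ₗ
            (LinearEquiv.ofInjective _ (injective_of_fullRank A)).toLinearMap
        refine ⟨fun a => L (EuclideanSpace.single a 1), Q_ext fun ⟨_, c, hc⟩ => ?_⟩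
        subst hc
        refine (qOfFrame_apply A _ c).trans ?_
        change _ = L c
        have h1 : c = ∑ a, c a • EuclideanSpace.single a (1 : ℂ) := by
          ext b
          simp [Pi.single_apply]
        conv_rhs => rw [h1]
        rw [map_sum]
        exact Finset.sum_congr rfl fun a _ => by rw [map_smul, smul_eq_mul, mul_comm])

/-- The coordinates of `𝒬` over an affine chart. -/
def qCoordEquiv (e : Fin r ⊕ Fin (N - r) ≃ Fin N) {p : Gr r N} (hp : p ∈ chartSource e) :
    Q p ≃ₗ[ℂ] (Fin r → ℂ) where
  toFun := qCoord e p
  invFun := qOfCoord e p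
  map_add' := fun _ _ => rfl
  map_smul' := fun _ _ => rfl
  left_inv := qOfCoord_qCoord e hp
  right_inv := qCoord_qOfCoord e hp

/-- The normalized representative is the identity in the rows selected by `e`, so the frame dual to
its columns consists of the coordinate functions of those rows. -/
theorem eq_sum_qCoord_smul_coordFun (e : Fin r ⊕ Fin (N - r) ≃ Fin N) {p : Gr r N}
    (hp : p ∈ chartSource e) (φ : Q p) :
    φ = ∑ a, qCoord e p φ a • coordFun p (e (Sum.inl a)) := by
  have h : (∑ a, qCoord e p φ a • coordFun p (e (Sum.inl a)) : Q p) = qOfCoord e p (qCoord e p φ) := by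
    refine Q_ext fun t => ?_
    refine Eq.trans ?_ (qOfCoord_apply e p _ t).symm
    let ev : Q p →ₗ[ℂ] ℂ :=
      { toFun := fun ψ => (show StrongDual ℂ (taut p) from ψ) t
        map_add' := fun _ _ => rfl
        map_smul' := fun _ _ => rfl }
    change ev _ = _
    rw [map_sum]
    rfl
  rw [h, qOfCoord_qCoord e hp]

/-- The matrix of the coordinate functions in a basis of the fibre of `𝒬`. -/
def coordMatrix {p : Gr r N} (L : Q p ≃ₗ[ℂ] (Fin r → ℂ)) : Matrix (Fin N) (Fin r) ℂ :=
  Matrix.of fun j a => L (coordFun p j) a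

theorem coordMatrix_qCoordEquiv (e : Fin r ⊕ Fin (N - r) ≃ Fin N) {p : Gr r N}
    (hp : p ∈ chartSource e) : coordMatrix (qCoordEquiv e hp) = normRep e p := rfl

/-- Another choice of linear coordinates multiplies the matrix of coordinate functions on the right
by an invertible matrix, which does not change its class. In the coordinates of an affine chart the
matrix is the normalized representative of `p`. -/
theorem exists_mk_coordMatrix {p : Gr r N} (L : Q p ≃ₗ[ℂ] (Fin r → ℂ)) :
    ∃ h : (coordMatrix L).rank = r, mk ⟨coordMatrix L, h⟩ = p := by
  obtain ⟨e, hp⟩ := exists_chart p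
  let T : (Fin r → ℂ) ≃ₗ[ℂ] (Fin r → ℂ) := (qCoordEquiv e hp).symm.trans L
  let g : Matrix (Fin r) (Fin r) ℂ := (LinearMap.toMatrix' T.toLinearMap)ᵀ
  have hg : IsUnit g.det := by
    rw [Matrix.det_transpose, LinearMap.det_toMatrix']
    exact LinearEquiv.isUnit_det' T
  have h1 : coordMatrix L = affineMatrix e (coords e p) * g := by
    rw [affineMatrix_coords e hp, ← coordMatrix_qCoordEquiv e hp]
    ext j a
    have : L (coordFun p j) = T (qCoordEquiv e hp (coordFun p j)) := by simp [T]
    change L (coordFun p j) a = ∑ b, qCoordEquiv e hp (coordFun p j) b * g b a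
    rw [this, ← LinearEquiv.coe_coe, ← LinearMap.toMatrix'_mulVec]
    simp only [Matrix.mulVec, dotProduct, g, Matrix.transpose_apply]
    exact Finset.sum_congr rfl fun b _ => mul_comm _ _
  have h2 : (coordMatrix L).rank = r := by
    rw [h1, Matrix.rank_mul_eq_left_of_isUnit_det _ _ hg]
    exact (affineFullRank e (coords e p)).2
  refine ⟨h2, ?_⟩
  rw [← mk_eq_of (A := affineFullRank e (coords e p)) hg.ne_zero h1, mk_affine_coords e hp]

theorem coordFun_eq_sum {p : Gr r N} (L : Q p ≃ₗ[ℂ] (Fin r → ℂ)) (j : Fin N) :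
    coordFun p j = ∑ a, coordMatrix L j a • L.symm (Pi.single a 1) := by
  apply L.injective
  rw [map_sum]
  funext b
  simp [coordMatrix, Pi.single_apply, Finset.sum_apply]

theorem metric_symm_single {p : Gr r N} (L : Q p ≃ₗ[ℂ] (Fin r → ℂ)) :
    Matrix.of (fun a b => metric p (L.symm (Pi.single a 1)) (L.symm (Pi.single b 1)))
      = ((coordMatrix L)ᴴ * coordMatrix L)⁻¹ := by
  obtain ⟨h, hp⟩ := exists_mk_coordMatrix L
  -- The fibre depends on the point, so the point is made a variable before the equality of points
  -- is substituted.
  have key : ∀ (q : Gr r N) (_ : mk ⟨coordMatrix L, h⟩ = q) (σ : Fin r → Q q),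
      (∀ j, coordFun q j = ∑ a, coordMatrix L j a • σ a) →
      Matrix.of (fun a b => metric q (σ a) (σ b)) = ((coordMatrix L)ᴴ * coordMatrix L)⁻¹ := by
    rintro q rfl σ hσ
    exact metric_frame ⟨coordMatrix L, h⟩ σ hσ
  exact key p hp _ (coordFun_eq_sum L)

theorem trivializationAt_apply (p₀ p : Gr r N) (φ : Q p) :
    (trivializationAt (Fin r → ℂ) (Q (r := r) (N := N)) p₀ ⟨p, φ⟩).2 = qCoord (rowsAt p₀) p φ := rfl

theorem gram_metric (p₀ : Gr r N) {p : Gr r N} (hp : p ∈ chartSource (rowsAt p₀)) :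
    gram (r := r) (metric (r := r) (N := N)) p₀ p
      = ((normRep (rowsAt p₀) p)ᴴ * normRep (rowsAt p₀) p)⁻¹ := by
  rw [← coordMatrix_qCoordEquiv _ hp, ← metric_symm_single]
  have h : ∀ d, (trivializationAt (Fin r → ℂ) (Q (r := r) (N := N)) p₀).symm p d
      = (qCoordEquiv _ hp).symm d := by
    intro d
    have := (trivializationAt (Fin r → ℂ) (Q (r := r) (N := N)) p₀).symm_apply_apply_mk (b := p) hp
      ((qCoordEquiv _ hp).symm d)
    rw [trivializationAt_apply] at this
    refine Eq.trans ?_ this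
    exact congrArg _ (LinearEquiv.apply_symm_apply (qCoordEquiv _ hp) d).symm
  ext a b
  simp only [gram, Matrix.of_apply, h]

end Gr

/-! ### The Kodaira map and the induced metric in local trivializations -/

section Kodaira

variable {n r N : ℕ} {M : Type*} [TopologicalSpace M] [ChartedSpace (Fin n → ℂ) M]
  {E : M → Type*} [∀ x, AddCommGroup (E x)] [∀ x, Module ℂ (E x)] [∀ x, TopologicalSpace (E x)]
  [TopologicalSpace (TotalSpace (Fin r → ℂ) E)] [FiberBundle (Fin r → ℂ) E]
  [VectorBundle ℂ (Fin r → ℂ) E]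

/-- The isomorphism `E = i_s^* 𝒬` on the fibre over `x`. -/
def kodairaEquiv (s : Fin N → H0 n r E) (hs : Spanning s) (x : M) :
    E x ≃ₗ[ℂ] Gr.Q (kodairaMap s hs x) :=
  ((trivializationAt (Fin r → ℂ) E x).linearEquivAt ℂ x (mem_baseSet_trivializationAt _ _ x)).trans
    (Gr.qFrameEquiv ⟨sectionMatrix s x, hs x⟩)

theorem kodairaEquiv_apply (s : Fin N → H0 n r E) (hs : Spanning s) (x : M) (v : E x) :
    kodairaEquiv s hs x v = kodairaFibre s hs x v := rfl

theorem kodairaEquiv_section (s : Fin N → H0 n r E) (hs : Spanning s) (x : M) (j : Fin N) :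
    kodairaEquiv s hs x (s j x) = Gr.coordFun (kodairaMap s hs x) j :=
  Gr.Q_ext fun t => kodairaFibre_apply s hs x j t

/-- This turns the balanced condition into a statement about the average of the projections onto the
subspaces `i_s(x)`. -/
theorem inducedMetric_section (s : Fin N → H0 n r E) (hs : Spanning s) (x : M) (j k : Fin N) :
    inducedMetric s hs x (s j x) (s k x) = Gr.proj (kodairaMap s hs x) j k := by
  rw [inducedMetric, ← kodairaEquiv_apply, ← kodairaEquiv_apply, kodairaEquiv_section,
    kodairaEquiv_section, Gr.metric_coordFun]

/-- The matrix of coordinates of the sections `s` in a trivialization. -/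
def frameMatrix (s : Fin N → H0 n r E) (e : Trivialization (Fin r → ℂ) (π (Fin r → ℂ) E)) (x : M) :
    Matrix (Fin N) (Fin r) ℂ := Matrix.of fun j a => (e ⟨x, s j x⟩).2 a

/-- The coordinates of the fibre of `𝒬` at `i_s(x)` induced by a trivialization of `E`. -/
def kodairaCoord (s : Fin N → H0 n r E) (hs : Spanning s)
    (e : Trivialization (Fin r → ℂ) (π (Fin r → ℂ) E)) [e.IsLinear ℂ] {x : M} (hx : x ∈ e.baseSet) :
    Gr.Q (kodairaMap s hs x) ≃ₗ[ℂ] (Fin r → ℂ) :=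
  (kodairaEquiv s hs x).symm.trans (e.linearEquivAt ℂ x hx)

theorem coordMatrix_kodairaCoord (s : Fin N → H0 n r E) (hs : Spanning s)
    (e : Trivialization (Fin r → ℂ) (π (Fin r → ℂ) E)) [e.IsLinear ℂ] {x : M} (hx : x ∈ e.baseSet) :
    Gr.coordMatrix (kodairaCoord s hs e hx) = frameMatrix s e x := by
  ext j a
  rw [Gr.coordMatrix, Matrix.of_apply, ← kodairaEquiv_section, kodairaCoord, LinearEquiv.trans_apply,
    LinearEquiv.symm_apply_apply]
  rfl

/-- `sectionMatrix` changes its trivialization with the point. Here one fixed trivialization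
represents the Kodaira map on its whole base set, so local formulas can be differentiated. -/
theorem exists_mk_frameMatrix (s : Fin N → H0 n r E) (hs : Spanning s)
    (e : Trivialization (Fin r → ℂ) (π (Fin r → ℂ) E)) [e.IsLinear ℂ] {x : M} (hx : x ∈ e.baseSet) :
    ∃ h : (frameMatrix s e x).rank = r, Gr.mk ⟨frameMatrix s e x, h⟩ = kodairaMap s hs x := by
  rw [← coordMatrix_kodairaCoord s hs e hx]
  exact Gr.exists_mk_coordMatrix _

theorem gram_inducedMetric (s : Fin N → H0 n r E) (hs : Spanning s) (x₀ : M) {x : M}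
    (hx : x ∈ (trivializationAt (Fin r → ℂ) E x₀).baseSet) :
    gram (inducedMetric s hs) x₀ x
      = ((frameMatrix s (trivializationAt (Fin r → ℂ) E x₀) x)ᴴ
          * frameMatrix s (trivializationAt (Fin r → ℂ) E x₀) x)⁻¹ := by
  rw [← coordMatrix_kodairaCoord s hs _ hx, ← Gr.metric_symm_single]
  rfl

theorem contMDiffOn_frameMatrix [ContMDiffVectorBundle ω (Fin r → ℂ) E 𝓘(ℂ, Fin n → ℂ)]
    (s : Fin N → H0 n r E) (x₀ : M) (j : Fin N) (a : Fin r) :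
    ContMDiffOn 𝓘(ℂ, Fin n → ℂ) 𝓘(ℂ, ℂ) ω
      (fun x => frameMatrix s (trivializationAt (Fin r → ℂ) E x₀) x j a)
      (trivializationAt (Fin r → ℂ) E x₀).baseSet := by
  have h := ((trivializationAt (Fin r → ℂ) E x₀).contMDiffOn_section_baseSet_iff
    (n := ω) (IB := 𝓘(ℂ, Fin n → ℂ)) (s := s j)).1 (s j).contMDiff.contMDiffOn
  have h2 : ContMDiff 𝓘(ℂ, Fin r → ℂ) 𝓘(ℂ, ℂ) ω (fun d : Fin r → ℂ => d a) :=
    (contDiff_apply ℂ ℂ a).contMDiff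
  exact h2.comp_contMDiffOn h

end Kodaira

end Balanced

end

noncomputable section

namespace Balanced

open Matrix Topology Set Filter

/-! ### The Kodaira map pulls `ω_Gr` back to the Ricci form -/

section Ricci

variable {n r N : ℕ}

open scoped ComplexOrder in
theorem FullRank.exists_det_gram (S : FullRank r N) :
    ∃ d : ℝ, 0 < d ∧ (S.1ᴴ * S.1).det = (d : ℂ) := by
  obtain ⟨h1, h2⟩ := Complex.lt_def.1 S.posDef_gram.det_pos
  exact ⟨_, h1, Complex.ext rfl h2.symm⟩

/-- The Gram determinant scales by `‖det g‖²`. When `g` varies holomorphically, the correction term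
is pluriharmonic. -/
theorem log_det_gram_mul (A S : FullRank r N) (g : Matrix (Fin r) (Fin r) ℂ) (hg : g.det ≠ 0)
    (h : S.1 = A.1 * g) :
    Real.log ((S.1ᴴ * S.1)⁻¹).det.re = Real.log ((A.1ᴴ * A.1)⁻¹).det.re - 2 * Real.log ‖g.det‖ := by
  obtain ⟨d, hd, hA⟩ := A.exists_det_gram
  have hg' : ‖g.det‖ ≠ 0 := norm_ne_zero_iff.2 hg
  have hS : (S.1ᴴ * S.1).det = ((‖g.det‖ ^ 2 * d : ℝ) : ℂ) := by
    have : S.1ᴴ * S.1 = gᴴ * (A.1ᴴ * A.1) * g := by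
      rw [h]; simp only [Matrix.conjTranspose_mul, Matrix.mul_assoc]
    rw [this, Matrix.det_mul, Matrix.det_mul, hA, Matrix.det_conjTranspose]
    push_cast
    rw [← Complex.conj_mul']
    simp only [starRingEnd_apply]
    ring
  rw [Matrix.det_nonsing_inv, Matrix.det_nonsing_inv, hS, hA, Ring.inverse_eq_inv',
    ← Complex.ofReal_inv, ← Complex.ofReal_inv, Complex.ofReal_re, Complex.ofReal_re, Real.log_inv,
    Real.log_inv, Real.log_mul (pow_ne_zero 2 hg') hd.ne', Real.log_pow]
  push_cast
  ring

/-- The potential of the Kähler form of `G(r, N)` in an affine chart. -/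
def grPotential (e : Fin r ⊕ Fin (N - r) ≃ Fin N) (B : Fin (N - r) → Fin r → ℂ) : ℂ :=
  (Real.log (((Gr.affineMatrix e B)ᴴ * Gr.affineMatrix e B)⁻¹).det.re : ℂ)

theorem contDiff_grPotential (e : Fin r ⊕ Fin (N - r) ≃ Fin N) :
    ContDiff ℝ 2 (grPotential e : (Fin (N - r) → Fin r → ℂ) → ℂ) := by
  have hA : ∀ i j, ContDiff ℝ 2 fun B : Fin (N - r) → Fin r → ℂ => Gr.affineMatrix e B i j :=
    fun i j => ((Gr.contDiff_affineMatrix e i j).restrict_scalars ℝ).of_le le_top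
  have hdet : ContDiff ℝ 2 fun B : Fin (N - r) → Fin r → ℂ =>
      ((Gr.affineMatrix e B)ᴴ * Gr.affineMatrix e B).det := by
    simp only [Matrix.det_apply']
    refine ContDiff.sum fun σ _ => contDiff_const.mul (contDiff_prod fun i _ => ?_)
    simp only [Matrix.mul_apply, Matrix.conjTranspose_apply]
    refine ContDiff.sum fun k _ => ContDiff.mul ?_ (hA _ _)
    exact Complex.conjCLE.contDiff.comp (hA _ _)
  have h0 : ∀ B : Fin (N - r) → Fin r → ℂ,
      0 < ((Gr.affineMatrix e B)ᴴ * Gr.affineMatrix e B).det.re := by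
    intro B
    obtain ⟨d, hd, hB⟩ := (Gr.affineFullRank e B).exists_det_gram
    have hB' : ((Gr.affineMatrix e B)ᴴ * Gr.affineMatrix e B).det = (d : ℂ) := hB
    rw [hB', Complex.ofReal_re]
    exact hd
  -- The Gram determinant is real and positive, so the potential is minus its logarithm, and no
  -- matrix inverse has to be differentiated.
  have heq : (grPotential e : (Fin (N - r) → Fin r → ℂ) → ℂ) = fun B =>
      ((-Real.log ((Gr.affineMatrix e B)ᴴ * Gr.affineMatrix e B).det.re : ℝ) : ℂ) := by
    funext B
    obtain ⟨d, hd, hB⟩ := (Gr.affineFullRank e B).exists_det_gram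
    have hB' : ((Gr.affineMatrix e B)ᴴ * Gr.affineMatrix e B).det = (d : ℂ) := hB
    rw [grPotential, Matrix.det_nonsing_inv, hB', Ring.inverse_eq_inv', ← Complex.ofReal_inv,
      Complex.ofReal_re, Complex.ofReal_re, Real.log_inv]
  rw [heq]
  refine Complex.ofRealCLM.contDiff.comp (ContDiff.neg (ContDiff.log ?_ fun B => (h0 B).ne'))
  exact Complex.reCLM.contDiff.comp hdet

variable {M : Type*} [TopologicalSpace M] [ChartedSpace (Fin n → ℂ) M]
  {E : M → Type*} [∀ x, AddCommGroup (E x)] [∀ x, Module ℂ (E x)] [∀ x, TopologicalSpace (E x)]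
  [TopologicalSpace (TotalSpace (Fin r → ℂ) E)] [FiberBundle (Fin r → ℂ) E]
  [VectorBundle ℂ (Fin r → ℂ) E]

/-- The matrix of the sections is the normalized representative of its class times its block of rows
selected by `e`, so `log_det_gram_mul` compares the two potentials. -/
theorem log_det_gram_inducedMetric (s : Fin N → H0 n r E) (hs : Spanning s) (x₀ : M) {x : M}
    (hx : x ∈ (trivializationAt (Fin r → ℂ) E x₀).baseSet)
    (e : Fin r ⊕ Fin (N - r) ≃ Fin N) (hp : kodairaMap s hs x ∈ Gr.chartSource e) :
    (Gr.topBlock e (frameMatrix s (trivializationAt (Fin r → ℂ) E x₀) x)).det ≠ 0 ∧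
    (Real.log (gram (r := r) (inducedMetric s hs) x₀ x).det.re : ℂ)
      = grPotential e (Gr.coords e (kodairaMap s hs x)) - 2 * Real.log
        ‖(Gr.topBlock e (frameMatrix s (trivializationAt (Fin r → ℂ) E x₀) x)).det‖ := by
  obtain ⟨h, hmk⟩ := exists_mk_frameMatrix s hs (trivializationAt (Fin r → ℂ) E x₀) hx
  rw [gram_inducedMetric s hs x₀ hx]
  generalize frameMatrix s (trivializationAt (Fin r → ℂ) E x₀) x = S at *
  have hdet : (Gr.topBlock e S).det ≠ 0 := by
    rw [← hmk] at hp
    exact (Gr.mk_mem_chartSource e _).1 hp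
  refine ⟨hdet, ?_⟩
  have h1 : S = Gr.affineMatrix e (Gr.coords e (kodairaMap s hs x)) * Gr.topBlock e S := by
    rw [Gr.affineMatrix_coords e hp, ← hmk, Gr.normRep_mk, Matrix.mul_assoc,
      Matrix.nonsing_inv_mul _ (isUnit_iff_ne_zero.2 hdet), Matrix.mul_one]
  have h2 := log_det_gram_mul (Gr.affineFullRank e (Gr.coords e (kodairaMap s hs x))) ⟨S, h⟩
    (Gr.topBlock e S) hdet h1
  change (Real.log (((⟨S, h⟩ : FullRank r N).1ᴴ * (⟨S, h⟩ : FullRank r N).1)⁻¹).det.re : ℂ) = _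
  rw [h2]
  push_cast
  rfl

/-- The Kodaira map pulls the Kähler form of `G(r, N)` back to the Ricci form of the induced
metric. -/
theorem kaehlerForm_kodairaMap [IsManifold 𝓘(ℂ, Fin n → ℂ) ω M]
    [ContMDiffVectorBundle ω (Fin r → ℂ) E 𝓘(ℂ, Fin n → ℂ)] (s : Fin N → H0 n r E) (hs : Spanning s)
    (hf : ContMDiff 𝓘(ℂ, Fin n → ℂ) 𝓘(ℂ, Fin (N - r) → Fin r → ℂ) ω (kodairaMap s hs)) (x : M)
    (v w : TangentSpace 𝓘(ℂ, Fin n → ℂ) x) :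
    Gr.kaehlerForm (kodairaMap s hs x)
      (mfderiv 𝓘(ℂ, Fin n → ℂ) 𝓘(ℂ, Fin (N - r) → Fin r → ℂ) (kodairaMap s hs) x v)
      (mfderiv 𝓘(ℂ, Fin n → ℂ) 𝓘(ℂ, Fin (N - r) → Fin r → ℂ) (kodairaMap s hs) x w)
      = ricci r (inducedMetric s hs) x v w := by
  set f := kodairaMap s hs with hfdef
  set φ := chartAt (Fin n → ℂ) x with hφ
  set e := Gr.rowsAt (f x) with he
  set t := trivializationAt (Fin r → ℂ) E x with ht
  have hxφ : x ∈ φ.source := mem_chart_source _ x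
  have hyφ : φ x ∈ φ.target := φ.map_source hxφ
  have hleft : φ.symm (φ x) = x := φ.left_inv hxφ
  -- `F` is the Kodaira map read in charts; `T` is the nonvanishing holomorphic determinant
  -- separating the local frame of `E` from the affine frame of `𝒬`.
  let F : (Fin n → ℂ) → (Fin (N - r) → Fin r → ℂ) := fun y => Gr.coords e (f (φ.symm y))
  let T : (Fin n → ℂ) → ℂ := fun y => (Gr.topBlock e (frameMatrix s t (φ.symm y))).det
  have hsymm : ContMDiffAt 𝓘(ℂ, Fin n → ℂ) 𝓘(ℂ, Fin n → ℂ) ω φ.symm (φ x) :=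
    (contMDiffOn_chart_symm (I := 𝓘(ℂ, Fin n → ℂ)) (n := ω) (x := x)).contMDiffAt
      (φ.open_target.mem_nhds hyφ)
  have hcoords : ContMDiffAt 𝓘(ℂ, Fin (N - r) → Fin r → ℂ) 𝓘(ℂ, Fin (N - r) → Fin r → ℂ) ω
      (Gr.coords e) (f x) :=
    (contMDiffOn_chart (I := 𝓘(ℂ, Fin (N - r) → Fin r → ℂ)) (n := ω) (x := f x)).contMDiffAt
      ((Gr.isOpen_chartSource e).mem_nhds (Gr.mem_rowsAt _))
  have hF : ContDiffAt ℂ ω F (φ x) := by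
    refine ContMDiffAt.contDiffAt ?_
    have h1 : ContMDiffAt 𝓘(ℂ, Fin n → ℂ) 𝓘(ℂ, Fin (N - r) → Fin r → ℂ) ω
        (Gr.coords e ∘ f) (φ.symm (φ x)) := by
      rw [hleft]
      exact hcoords.comp x hf.contMDiffAt
    exact h1.comp (φ x) hsymm
  have hbase : t.baseSet ∈ 𝓝 x :=
    t.open_baseSet.mem_nhds (mem_baseSet_trivializationAt _ _ x)
  have hT : ContDiffAt ℂ ω T (φ x) := by
    have hS : ∀ i j, ContDiffAt ℂ ω (fun y => frameMatrix s t (φ.symm y) i j) (φ x) := by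
      intro i j
      refine ContMDiffAt.contDiffAt ?_
      have h1 : ContMDiffAt 𝓘(ℂ, Fin n → ℂ) 𝓘(ℂ, ℂ) ω (fun x => frameMatrix s t x i j)
          (φ.symm (φ x)) := by
        rw [hleft]
        exact (contMDiffOn_frameMatrix s x i j).contMDiffAt hbase
      exact h1.comp (φ x) hsymm
    simp only [T, Matrix.det_apply', Gr.topBlock]
    exact ContDiffAt.sum fun σ _ => contDiffAt_const.mul (contDiffAt_prod fun i _ => hS _ _)
  have hcont : Tendsto φ.symm (𝓝 (φ x)) (𝓝 x) := by
    have := (φ.continuousAt_symm hyφ).tendsto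
    rwa [hleft] at this
  have hev1 : ∀ᶠ y in 𝓝 (φ x), φ.symm y ∈ t.baseSet := hcont.eventually hbase
  have hev2 : ∀ᶠ y in 𝓝 (φ x), f (φ.symm y) ∈ Gr.chartSource e :=
    hcont.eventually (hf.continuous.continuousAt.eventually
      ((Gr.isOpen_chartSource e).mem_nhds (Gr.mem_rowsAt (f x))))
  have hT0 : T (φ x) ≠ 0 :=
    (log_det_gram_inducedMetric s hs x hev1.self_of_nhds e hev2.self_of_nhds).1
  obtain ⟨G, hG, hGT⟩ := exists_re_eq_log_norm hT hT0
  have hpot : (fun y => (Real.log (gram (r := r) (inducedMetric s hs) x (φ.symm y)).det.re : ℂ))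
      =ᶠ[𝓝 (φ x)] fun y => grPotential e (F y) + (((-2) * G y).re : ℂ) := by
    filter_upwards [hev1, hev2, hGT] with y hy1 hy2 hy3
    rw [(log_det_gram_inducedMetric s hs x hy1 e hy2).2]
    have : ((-2 : ℂ) * G y).re = -2 * Real.log ‖T y‖ := by rw [← hy3]; simp
    rw [this]
    push_cast
    ring
  -- The chart of `G(r, N)` and the trivialization of `𝒬` at `f x` use the same rows `e`, and the
  -- chart is onto the affine space, so the equality of potentials is global.
  have hpotGr : (fun B => (Real.log (gram (r := r) (Gr.metric (r := r) (N := N)) (f x)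
      ((chartAt (Fin (N - r) → Fin r → ℂ) (f x)).symm B)).det.re : ℂ)) = grPotential e := by
    funext B
    change (Real.log (gram (r := r) (Gr.metric (r := r) (N := N)) (f x)
      (Gr.mk (Gr.affineFullRank e B))).det.re : ℂ) = _
    rw [Gr.gram_metric _ (Gr.affine_mem e B), Gr.normRep_affine]
    rfl
  have hchain : ∀ a : TangentSpace 𝓘(ℂ, Fin n → ℂ) x,
      fderiv ℂ F (φ x) (mfderiv 𝓘(ℂ, Fin n → ℂ) 𝓘(ℂ, Fin n → ℂ) φ x a)
        = mfderiv 𝓘(ℂ, Fin (N - r) → Fin r → ℂ) 𝓘(ℂ, Fin (N - r) → Fin r → ℂ)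
          (Gr.coords e) (f x)
          (mfderiv 𝓘(ℂ, Fin n → ℂ) 𝓘(ℂ, Fin (N - r) → Fin r → ℂ) f x a) := by
    intro a
    have hφd : MDifferentiableAt 𝓘(ℂ, Fin n → ℂ) 𝓘(ℂ, Fin n → ℂ) φ x :=
      ((contMDiffOn_chart (I := 𝓘(ℂ, Fin n → ℂ)) (n := ω) (x := x)).contMDiffAt
        (φ.open_source.mem_nhds hxφ)).mdifferentiableAt (by simp)
    have hFd : MDifferentiableAt 𝓘(ℂ, Fin n → ℂ) 𝓘(ℂ, Fin (N - r) → Fin r → ℂ) F (φ x) :=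
      (hF.differentiableAt (by simp)).mdifferentiableAt
    have h1 := mfderiv_comp x hFd hφd
    have h2 := mfderiv_comp x (hcoords.mdifferentiableAt (by simp))
      (hf.contMDiffAt.mdifferentiableAt (x := x) (by simp))
    have h3 : F ∘ φ =ᶠ[𝓝 x] Gr.coords e ∘ f := by
      filter_upwards [φ.open_source.mem_nhds hxφ] with z hz
      simp [F, φ.left_inv hz]
    rw [h3.mfderiv_eq, h2] at h1
    rw [mfderiv_eq_fderiv] at h1
    exact (congrArg (fun L => L a) h1).symm
  have hFx : F (φ x) = Gr.coords e (f x) := by simp only [F, hleft]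
  have key := ddbar_comp_add_re (F := F) (G := fun y => (-2) * G y) (u := grPotential e)
    (contDiff_grPotential e).contDiffAt (hF.of_le le_top) (contDiffAt_const.mul (hG.of_le le_top)) hpot
    (mfderiv 𝓘(ℂ, Fin n → ℂ) 𝓘(ℂ, Fin n → ℂ) φ x v)
    (mfderiv 𝓘(ℂ, Fin n → ℂ) 𝓘(ℂ, Fin n → ℂ) φ x w)
  rw [Gr.kaehlerForm, ricci, ricci, hpotGr, key, hchain, hchain, hFx]
  rfl

end Ricci

end Balanced

end

noncomputable section

namespace Balanced

open Matrix Topology Set Filter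

/-! ### The holomorphic isomorphism `f^* 𝒬 ≅ E` -/

section Pullback

variable {n r N : ℕ} {M : Type*} [TopologicalSpace M] [ChartedSpace (Fin n → ℂ) M]

theorem pullback_trivializationAt_apply
    (f : ContMDiffMap 𝓘(ℂ, Fin n → ℂ) 𝓘(ℂ, Fin (N - r) → Fin r → ℂ) M (Gr r N) ω) (x₀ : M)
    (z : TotalSpace (Fin r → ℂ) (f *ᵖ (Gr.Q (r := r) (N := N)))) :
    (trivializationAt (Fin r → ℂ) (f *ᵖ (Gr.Q (r := r) (N := N))) x₀ z).2
      = Gr.qCoord (Gr.rowsAt (f x₀)) (f z.1) z.2 := rfl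

/-- The coordinate functions are holomorphic sections of `f^* 𝒬`. -/
theorem contMDiff_pullback_coordFun
    (f : ContMDiffMap 𝓘(ℂ, Fin n → ℂ) 𝓘(ℂ, Fin (N - r) → Fin r → ℂ) M (Gr r N) ω) (j : Fin N) :
    ContMDiff 𝓘(ℂ, Fin n → ℂ) (𝓘(ℂ, Fin n → ℂ).prod 𝓘(ℂ, Fin r → ℂ)) ω
      (fun x => (⟨x, Gr.coordFun (f x) j⟩ :
        TotalSpace (Fin r → ℂ) (f *ᵖ (Gr.Q (r := r) (N := N))))) := by
  intro x₀
  refine (Bundle.contMDiffAt_section (F := Fin r → ℂ) (E := f *ᵖ (Gr.Q (r := r) (N := N)))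
    (s := fun x => Gr.coordFun (f x) j) x₀).2 ?_
  simp only [pullback_trivializationAt_apply]
  refine contMDiffAt_pi_space.2 fun a => ?_
  exact ((Gr.contMDiffOn_normRep (Gr.rowsAt (f x₀)) j a).contMDiffAt
    ((Gr.isOpen_chartSource _).mem_nhds (Gr.mem_rowsAt _))).comp x₀ f.contMDiff.contMDiffAt

variable {E : M → Type*} [∀ x, AddCommGroup (E x)] [∀ x, Module ℂ (E x)]
  [∀ x, TopologicalSpace (E x)] [TopologicalSpace (TotalSpace (Fin r → ℂ) E)]
  [FiberBundle (Fin r → ℂ) E] [VectorBundle ℂ (Fin r → ℂ) E]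
  [ContMDiffVectorBundle ω (Fin r → ℂ) E 𝓘(ℂ, Fin n → ℂ)]

/-- If fibrewise isomorphisms `E = f^* 𝒬` match sections of `E` with the coordinate functions, then
`f^* 𝒬` is holomorphically isomorphic to `E`. -/
theorem holomorphicIso_of_coordFun (s : Fin N → H0 n r E)
    (f : ContMDiffMap 𝓘(ℂ, Fin n → ℂ) 𝓘(ℂ, Fin (N - r) → Fin r → ℂ) M (Gr r N) ω)
    (K : ∀ x, E x ≃ₗ[ℂ] Gr.Q (f x)) (hK : ∀ x j, K x (s j x) = Gr.coordFun (f x) j) :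
    HolomorphicIso n r (f *ᵖ (Gr.Q (r := r) (N := N))) E := by
  refine ⟨fun x => (K x).symm, fun z₀ => ?_⟩
  refine Bundle.contMDiffAt_totalSpace.2 ⟨Bundle.contMDiffAt_proj _, ?_⟩
  set t := trivializationAt (Fin r → ℂ) E z₀.1 with ht
  set e := Gr.rowsAt (f z₀.1) with he
  have hproj : ContMDiff (𝓘(ℂ, Fin n → ℂ).prod 𝓘(ℂ, Fin r → ℂ)) 𝓘(ℂ, Fin n → ℂ) ω
      (fun z : TotalSpace (Fin r → ℂ) (f *ᵖ (Gr.Q (r := r) (N := N))) => z.1) :=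
    Bundle.contMDiff_proj _
  have hev1 : ∀ᶠ z : TotalSpace (Fin r → ℂ) (f *ᵖ (Gr.Q (r := r) (N := N))) in 𝓝 z₀,
      z.1 ∈ t.baseSet := hproj.continuous.continuousAt.eventually
    (t.open_baseSet.mem_nhds (mem_baseSet_trivializationAt _ _ _))
  have hev2 : ∀ᶠ z : TotalSpace (Fin r → ℂ) (f *ᵖ (Gr.Q (r := r) (N := N))) in 𝓝 z₀,
      f z.1 ∈ Gr.chartSource e :=
    (f.contMDiff.continuous.comp hproj.continuous).continuousAt.eventually
      ((Gr.isOpen_chartSource e).mem_nhds (Gr.mem_rowsAt _))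
  have hq : ContMDiffAt (𝓘(ℂ, Fin n → ℂ).prod 𝓘(ℂ, Fin r → ℂ)) 𝓘(ℂ, Fin r → ℂ) ω
      (fun z : TotalSpace (Fin r → ℂ) (f *ᵖ (Gr.Q (r := r) (N := N))) =>
        Gr.qCoord e (f z.1) z.2) z₀ :=
    (Bundle.contMDiffAt_totalSpace.1 (contMDiffAt_id (x := z₀))).2
  have hS : ∀ j b, ContMDiffAt (𝓘(ℂ, Fin n → ℂ).prod 𝓘(ℂ, Fin r → ℂ)) 𝓘(ℂ, ℂ) ω
      (fun z : TotalSpace (Fin r → ℂ) (f *ᵖ (Gr.Q (r := r) (N := N))) =>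
        frameMatrix s t z.1 j b) z₀ := fun j b =>
    ((contMDiffOn_frameMatrix s z₀.1 j b).contMDiffAt
      (t.open_baseSet.mem_nhds (mem_baseSet_trivializationAt _ _ _))).comp z₀ hproj.contMDiffAt
  -- Over the chart, an element of `𝒬` is the combination of the coordinate functions of the rows `e
  -- (inl a)` with its coordinates as coefficients. The inverse of `K` replaces these functions by
  -- the corresponding sections, which gives this holomorphic local formula.
  have hmain : ContMDiffAt (𝓘(ℂ, Fin n → ℂ).prod 𝓘(ℂ, Fin r → ℂ)) 𝓘(ℂ, Fin r → ℂ) ω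
      (fun z : TotalSpace (Fin r → ℂ) (f *ᵖ (Gr.Q (r := r) (N := N))) => fun b =>
        ∑ a, Gr.qCoord e (f z.1) z.2 a * frameMatrix s t z.1 (e (Sum.inl a)) b) z₀ := by
    refine contMDiffAt_pi_space.2 fun b => ?_
    refine ContMDiffAt.sum fun a _ => ContMDiffAt.mul ?_ (hS _ _)
    exact contMDiffAt_pi_space.1 hq a
  refine hmain.congr_of_eventuallyEq ?_
  filter_upwards [hev1, hev2] with z hz1 hz2
  have h1 := Gr.eq_sum_qCoord_smul_coordFun e hz2 z.2
  have h2 : (K z.1).symm z.2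
      = ∑ a, Gr.qCoord e (f z.1) z.2 a • s (e (Sum.inl a)) z.1 := by
    refine (LinearEquiv.symm_apply_eq (K z.1)).2 ?_
    rw [map_sum]
    refine h1.trans (Finset.sum_congr rfl fun a _ => ?_)
    rw [map_smul, hK]
  change t.linearEquivAt ℂ z.1 hz1 ((K z.1).symm z.2) = _
  rw [h2, map_sum]
  funext b
  simp only [map_smul, Finset.sum_apply, Pi.smul_apply, smul_eq_mul]
  rfl

end Pullback

end Balanced

end

noncomputable section

namespace Balanced

open Matrix Topology Set Filter

/-! ### Comparison of two Kodaira maps through the sections of `E` -/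

section Sections

variable {n r N : ℕ} {M : Type*} [TopologicalSpace M] [ChartedSpace (Fin n → ℂ) M]
variable {E : M → Type*} [∀ x, AddCommGroup (E x)] [∀ x, Module ℂ (E x)]
  [∀ x, TopologicalSpace (E x)] [TopologicalSpace (TotalSpace (Fin r → ℂ) E)]
  [FiberBundle (Fin r → ℂ) E] [VectorBundle ℂ (Fin r → ℂ) E]
  {E' : M → Type*} [∀ x, AddCommGroup (E' x)] [∀ x, Module ℂ (E' x)]
  [∀ x, TopologicalSpace (E' x)] [TopologicalSpace (TotalSpace (Fin r → ℂ) E')]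
  [FiberBundle (Fin r → ℂ) E'] [VectorBundle ℂ (Fin r → ℂ) E']

theorem sum_smul_section_apply (c : Fin N → ℂ) (τ : Fin N → H0 n r E) (x : M) :
    (∑ j, c j • τ j : H0 n r E) x = ∑ j, c j • τ j x := by
  have h := congrFun (map_sum (ContMDiffSection.coeAddHom 𝓘(ℂ, Fin n → ℂ) (Fin r → ℂ) ω E)
    (fun j => c j • τ j) Finset.univ) x
  rw [Finset.sum_apply] at h
  exact h

/-- If `E` is isomorphic to the pullback of `𝒬` under the Kodaira map of a basis `t` of the sections
of another bundle, then that Kodaira map is obtained from the one of a basis `s` of `H⁰(M, E)` by a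
linear isomorphism. -/
theorem exists_mulLeft_of_holomorphicIso [ContMDiffVectorBundle ω (Fin r → ℂ) E 𝓘(ℂ, Fin n → ℂ)]
    (s : Module.Basis (Fin N) ℂ (H0 n r E)) (hs : Spanning s)
    (t : Module.Basis (Fin N) ℂ (H0 n r E')) (ht : Spanning t)
    (g : ContMDiffMap 𝓘(ℂ, Fin n → ℂ) 𝓘(ℂ, Fin (N - r) → Fin r → ℂ) M (Gr r N) ω)
    (hg : g = kodairaMap t ht) (hiso : HolomorphicIso n r (g *ᵖ (Gr.Q (r := r) (N := N))) E) :
    ∃ A : GL (Fin N) ℂ, ∀ x, ∃ S : FullRank r N,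
      kodairaMap s hs x = Gr.mk S ∧ g x = Gr.mk (S.mulLeft A) := by
  obtain ⟨Φ, hΦ⟩ := hiso
  let σ : Fin N → H0 n r E := fun j =>
    ⟨fun x => Φ x (Gr.coordFun (g x) j), hΦ.comp (contMDiff_pullback_coordFun g j)⟩
  let Ψ : ∀ x, Gr.Q (g x) ≃ₗ[ℂ] E x := Φ
  -- A linear relation among the `σ j` gives the same relation among the coordinate functions on
  -- every `g x`. Under `E' = g^* 𝒬` these functions are the values of the basis `t`, so all
  -- coefficients vanish.
  have hli : LinearIndependent ℂ σ := by
    rw [Fintype.linearIndependent_iff]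
    intro c hc
    have h1 : ∑ j, c j • t j = 0 := by
      ext x
      have h2 : Ψ x (∑ j, c j • Gr.coordFun (g x) j) = 0 := by
        have h3 := sum_smul_section_apply c σ x
        rw [hc] at h3
        refine Eq.trans ?_ h3.symm
        rw [map_sum]
        exact Finset.sum_congr rfl fun j _ => map_smul (Ψ x) _ _
      have h4 : (∑ j, c j • Gr.coordFun (g x) j) = 0 := (LinearEquiv.map_eq_zero_iff (Ψ x)).1 h2
      rw [hg] at h4
      have h5 : kodairaEquiv t ht x (∑ j, c j • t j x) = 0 := by
        rw [map_sum, ← h4]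
        exact Finset.sum_congr rfl fun j _ => by rw [map_smul, kodairaEquiv_section]
      rw [sum_smul_section_apply]
      exact (LinearEquiv.map_eq_zero_iff _).1 h5
    exact fun i => Fintype.linearIndependent_iff.1 t.linearIndependent c h1 i
  let A : Matrix (Fin N) (Fin N) ℂ := Matrix.of fun j k => s.repr (σ j) k
  have hA : IsUnit A := by
    rw [← Matrix.linearIndependent_rows_iff_isUnit]
    exact hli.map' s.equivFun.toLinearMap (LinearEquiv.ker _)
  refine ⟨hA.unit, fun x => ⟨⟨sectionMatrix s x, hs x⟩, rfl, ?_⟩⟩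
  -- In the coordinates on the fibre at `g x` carried over from `E`, the matrix of coordinate
  -- functions is the matrix of the `σ j`, which is `A` times that of `s`. By
  -- `exists_mk_coordMatrix` it represents `g x`.
  let L : Gr.Q (g x) ≃ₗ[ℂ] (Fin r → ℂ) := LinearEquiv.trans (Ψ x)
    ((trivializationAt (Fin r → ℂ) E x).linearEquivAt ℂ x (mem_baseSet_trivializationAt _ _ x))
  obtain ⟨h, hmk⟩ := Gr.exists_mk_coordMatrix L
  rw [← hmk]
  congr 1
  refine Subtype.ext ?_
  ext j a
  have h1 : σ j x = ∑ k, A j k • s k x := by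
    rw [← sum_smul_section_apply, ← s.sum_repr (σ j)]
    rfl
  change (trivializationAt (Fin r → ℂ) E x).linearEquivAt ℂ x (mem_baseSet_trivializationAt _ _ x)
    (σ j x) a = ∑ k, A j k * sectionMatrix s x k a
  rw [h1, map_sum, Finset.sum_apply]
  refine Finset.sum_congr rfl fun k _ => ?_
  rw [map_smul]
  rfl

end Sections

/-! ### Balanced maps differing by a linear isomorphism differ by a unitary one -/

section Uniqueness

variable {n r N : ℕ} {M : Type*} [TopologicalSpace M] [ChartedSpace (Fin n → ℂ) M]
  [CompactSpace M] [T2Space M]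

theorem IsBalancedBasis.average_proj {E : M → Type*} [∀ x, AddCommGroup (E x)]
    [∀ x, Module ℂ (E x)] [∀ x, TopologicalSpace (E x)]
    [TopologicalSpace (TotalSpace (Fin r → ℂ) E)] [FiberBundle (Fin r → ℂ) E]
    [VectorBundle ℂ (Fin r → ℂ) E]
    {Ω : KaehlerForm n M} {s : Module.Basis (Fin N) ℂ (H0 n r E)}
    {hs : Spanning s} (h : IsBalancedBasis Ω s hs) (j k : Fin N) :
    (1 / volIntegral Ω fun _ => 1) * volIntegral Ω (fun x => Gr.proj (kodairaMap s hs x) j k)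
      = if j = k then (r : ℂ) / N else 0 := by
  rw [← h j k, l2]
  simp only [inducedMetric_section]

variable [IsManifold 𝓘(ℂ, Fin n → ℂ) ω M]


/-- The trace is a fixed linear combination of the entries of `P x`, so the integral passes to the
entries. -/
theorem volIntegral_trace_mul (Ω : KaehlerForm n M) {P : M → Matrix (Fin N) (Fin N) ℂ}
    (hP : Continuous P) {a : ℂ}
    (h : ∀ j k, volIntegral Ω (fun x => P x j k) = if j = k then a else 0)
    (Y : Matrix (Fin N) (Fin N) ℂ) :
    volIntegral Ω (fun x => (P x * Y).trace) = a * Y.trace := by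
  have hc : ∀ j k, Continuous fun x => P x j k := fun j k => hP.matrix_elem j k
  let F : C(M, ℂ) := ∑ j, ∑ k, Y k j • (⟨fun x => P x j k, hc j k⟩ : C(M, ℂ))
  have hF : ∀ x, F x = (P x * Y).trace := by
    intro x
    simp [F, Matrix.trace, Matrix.mul_apply, ContinuousMap.sum_apply, mul_comm]
  have h1 : volIntegral Ω (fun x => (P x * Y).trace) = volFunctional Ω F :=
    congrArg _ (funext fun x => (hF x).symm)
  have h2 : ∀ j k, volFunctional Ω (⟨fun x => P x j k, hc j k⟩ : C(M, ℂ)) = if j = k then a else 0 :=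
    h
  rw [h1]
  simp only [F, map_sum, map_smul, h2, smul_eq_mul]
  simp [Matrix.trace, Finset.mul_sum, mul_comm]

/-- Two balanced families of subspaces that differ by a fixed linear isomorphism differ by a unitary
transformation. -/
theorem exists_unitaryMap_of_balanced (Ω : KaehlerForm n M) {f g : M → Gr r N} (hf : Continuous f)
    (hg : Continuous g) (A : GL (Fin N) ℂ)
    (hfg : ∀ x, ∃ S : FullRank r N, f x = Gr.mk S ∧ g x = Gr.mk (S.mulLeft A)) {a : ℂ}
    (hbf : ∀ j k, (1 / volIntegral Ω fun _ => 1) * volIntegral Ω (fun x => Gr.proj (f x) j k)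
      = if j = k then a else 0)
    (hbg : ∀ j k, (1 / volIntegral Ω fun _ => 1) * volIntegral Ω (fun x => Gr.proj (g x) j k)
      = if j = k then a else 0) :
    ∃ U : Matrix.unitaryGroup (Fin N) ℂ, ∀ x, g x = Gr.unitaryMap U (f x) := by
  set V := volIntegral Ω fun _ => 1 with hV
  -- Zero volume forces `M` to be empty: otherwise the constant function `1` would vanish at a
  -- point. Any unitary matrix then works.
  by_cases hV0 : V = 0
  · refine ⟨1, fun x => absurd ?_ (one_ne_zero (α := ℝ))⟩
    refine eq_zero_of_volIntegral_eq_zero Ω (f := fun _ => 1) continuous_const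
      (fun _ => zero_le_one) ?_ x
    simpa [hV] using hV0
  have hsolve : ∀ {I : ℂ} {c : ℂ}, (1 / V) * I = c → I = V * c := by
    intro I c h
    rw [← h]; field_simp
  have hIf : ∀ j k, volIntegral Ω (fun x => Gr.proj (f x) j k) = if j = k then V * a else 0 := by
    intro j k
    rw [hsolve (hbf j k)]; split_ifs <;> simp
  have hIg : ∀ j k, volIntegral Ω (fun x => Gr.proj (g x) j k) = if j = k then V * a else 0 := by
    intro j k
    rw [hsolve (hbg j k)]; split_ifs <;> simp
  have hPf : Continuous fun x => Gr.proj (f x) := Gr.continuous_proj.comp hf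
  have hPg : Continuous fun x => Gr.proj (g x) := Gr.continuous_proj.comp hg
  let C : M → Matrix (Fin N) (Fin N) ℂ := fun x => defect A (Gr.proj (f x)) (Gr.proj (g x))
  have hC : Continuous C := by
    change Continuous fun x => (Gr.proj (f x) - (A⁻¹).1 * Gr.proj (g x) * A.1) * (A⁻¹).1
    exact (hPf.sub ((continuous_const.matrix_mul hPg).matrix_mul continuous_const)).matrix_mul
      continuous_const
  have htr : ∀ x, ((∑ i, ∑ j, ‖C x i j‖ ^ 2 : ℝ) : ℂ)
      = (Gr.proj (f x) * ((A⁻¹).1 * (A⁻¹).1ᴴ)).trace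
        - (Gr.proj (g x) * ((A⁻¹).1ᴴ * (A⁻¹).1)).trace := by
    intro x
    obtain ⟨S, hSf, hSg⟩ := hfg x
    rw [← trace_mul_conjTranspose_self_eq]
    simp only [C, hSf, hSg, Gr.proj_mk]
    exact trace_defect A S
  have hint : volIntegral Ω (fun x => ((∑ i, ∑ j, ‖C x i j‖ ^ 2 : ℝ) : ℂ)) = 0 := by
    have h1 := volIntegral_trace_mul Ω hPf hIf ((A⁻¹).1 * (A⁻¹).1ᴴ)
    have h2 := volIntegral_trace_mul Ω hPg hIg ((A⁻¹).1ᴴ * (A⁻¹).1)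
    have c1 : Continuous fun x => (Gr.proj (f x) * ((A⁻¹).1 * (A⁻¹).1ᴴ)).trace :=
      (hPf.matrix_mul continuous_const).matrix_trace
    have c2 : Continuous fun x => (Gr.proj (g x) * ((A⁻¹).1ᴴ * (A⁻¹).1)).trace :=
      (hPg.matrix_mul continuous_const).matrix_trace
    simp only [htr]
    refine (map_sub (volFunctional Ω) ⟨_, c1⟩ ⟨_, c2⟩).trans ?_
    refine (congrArg₂ (· - ·) h1 h2).trans ?_
    -- The two integrals are the same multiple of `tr(X Xᴴ)` and `tr(Xᴴ X)`, with `X = A⁻¹`; this is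
    -- where equality of the two averages is used.
    rw [Matrix.trace_mul_comm, sub_self]
  have hzero : ∀ x, C x = 0 := by
    intro x
    have h1 := eq_zero_of_volIntegral_eq_zero Ω (f := fun x => ∑ i, ∑ j, ‖C x i j‖ ^ 2)
      (continuous_finsetSum _ fun i _ => continuous_finsetSum _ fun j _ =>
        (hC.matrix_elem i j).norm.pow 2)
      (fun x => Finset.sum_nonneg fun i _ => Finset.sum_nonneg fun j _ => sq_nonneg _) hint x
    ext i j
    have h2 := (Finset.sum_eq_zero_iff_of_nonneg fun i _ =>
      Finset.sum_nonneg fun j _ => sq_nonneg _).1 h1 i (Finset.mem_univ i)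
    have h3 := (Finset.sum_eq_zero_iff_of_nonneg fun j _ => sq_nonneg _).1 h2 j (Finset.mem_univ j)
    simpa using h3
  -- The polar decomposition involves `A` alone, so one `U` serves every `x`; the point enters only
  -- through the commutation of `R` with the projection.
  obtain ⟨U, R, hR, hAUR, hcomm⟩ := exists_polar A
  refine ⟨U, fun x => ?_⟩
  obtain ⟨S, hSf, hSg⟩ := hfg x
  have h0 := hzero x
  simp only [C, hSf, hSg, Gr.proj_mk] at h0
  rw [hSf, hSg]
  exact Gr.unitaryMap_mk_of_commute A U R hR hAUR S
    (hcomm _ (Gr.commute_of_defect_eq_zero A S h0))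

end Uniqueness

end Balanced

end

/-! ### Existence and uniqueness of the balanced Kähler embedding -/

theorem mainTheorem4 {n r N : ℕ} {M : Type u} [TopologicalSpace M] [CompactSpace M]
    [T2Space M] [ChartedSpace (Fin n → ℂ) M] [IsManifold 𝓘(ℂ, Fin n → ℂ) ω M]
    (Ω : KaehlerForm n M)
    {E : M → Type v} [∀ x, AddCommGroup (E x)] [∀ x, Module ℂ (E x)] [∀ x, TopologicalSpace (E x)]
    [TopologicalSpace (TotalSpace (Fin r → ℂ) E)] [FiberBundle (Fin r → ℂ) E]
    [VectorBundle ℂ (Fin r → ℂ) E] [ContMDiffVectorBundle ω (Fin r → ℂ) E 𝓘(ℂ, Fin n → ℂ)]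
    (hE : IsVeryAmple n r E) (hN : Module.finrank ℂ (H0 n r E) = N)
    (h : HermitianMetric n r E) (hbal : IsBalancedMetric Ω h)
    (hRic : ∀ (x : M) (v w : TangentSpace 𝓘(ℂ, Fin n → ℂ) x),
      ricci r h.toFun x v w = (Ω.toFun x v w : ℂ)) :
    ∃ f : ContMDiffMap 𝓘(ℂ, Fin n → ℂ) 𝓘(ℂ, Fin (N - r) → Fin r → ℂ) M (Gr r N) ω,
      IsBalancedKaehlerEmbedding Ω E f ∧
        ∀ g : ContMDiffMap 𝓘(ℂ, Fin n → ℂ) 𝓘(ℂ, Fin (N - r) → Fin r → ℂ) M (Gr r N) ω,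
          IsBalancedKaehlerEmbedding Ω E g →
            ∃ U : Matrix.unitaryGroup (Fin N) ℂ, ∀ x, g x = Gr.unitaryMap U (f x) := by
  obtain ⟨N', s, hs, hh, hb⟩ := hbal
  -- The balanced metric comes with a basis of its own size, which must be the dimension of `H⁰(M,
  -- E)`.
  have hNN : N' = N := by simpa [Module.finrank_eq_card_basis s] using hN
  subst hNN
  obtain ⟨_, hemb⟩ := hE.2 _ s
  let f : ContMDiffMap 𝓘(ℂ, Fin n → ℂ) 𝓘(ℂ, Fin (N' - r) → Fin r → ℂ) M (Gr r N') ω :=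
    ⟨kodairaMap s hs, hemb.contMDiff⟩
  refine ⟨f, ⟨?_, ?_, hemb, ?_⟩, fun g hg => ?_⟩
  · exact ⟨E, inferInstance, inferInstance, inferInstance, inferInstance, inferInstance,
      inferInstance, inferInstance, hE, s, hs, hb, rfl⟩
  · intro x v w
    refine (kaehlerForm_kodairaMap s hs hemb.contMDiff x v w).trans ?_
    rw [← hh, hRic]
  · exact holomorphicIso_of_coordFun s f (kodairaEquiv s hs)
      fun x j => kodairaEquiv_section s hs x j
  -- The bundle `E'` that makes `g` balanced need not be `E` itself; the two are compared only
  -- through `g^* 𝒬 ≅ E`.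
  · obtain ⟨E', _, _, _, _, _, _, _, _, t, ht, htb, hgk⟩ := hg.balanced
    obtain ⟨A, hA⟩ := exists_mulLeft_of_holomorphicIso s hs t ht g hgk hg.pullback
    refine exists_unitaryMap_of_balanced Ω f.contMDiff.continuous g.contMDiff.continuous A hA
      hb.average_proj ?_
    rw [hgk]
    exact htb.average_proj
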